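/- Theorem (Convergence rate and sample complexity of MA-SABA). Let $F_1,\dots,F_n$ be $C^1$ and $G_1,\dots,G_m$ be $C^2$ real functions on $\mathbb R^{d_x}\times\mathbb R^{d_y}$, $n,m\ge 1$, and put $f=\frac1n\sum_i F_i$, $g=\frac1m\sum_j G_j$. Let $L^f,L_1^g,L_2^g\ge 0$ and $C^f,\mu>0$, and assume: (A1) $\nabla f$ is $L^f$-Lipschitz; $g(x,\cdot)$ is $\mu$-strongly convex for every $x$; $\nabla g$ and $\nabla^2 g$ are $L_1^g$- and $L_2^g$-Lipschitz in $(x,y)$; with $y^*(x)=\arg\min_y g(x,y)$, $\|\nabla_2 f(x,y^*(x))\|\le C^f$ for every $x$; (A2) every $\nabla F_i$ is $L^f$-Lipschitz, every $\nabla G_j$ is $L_1^g$-Lipschitz and every $\nabla^2 G_j$ is $L_2^g$-Lipschitz in $(x,y)$ (Euclidean norms, and operator norms for Hessians). Let $H(x)=f(x,y^*(x))$. MA-SABA with constant parameters $\alpha,\beta,\gamma,\rho$ is the following method. Its input consists of the points $u_{-1}=(x_{-1},y_{-1},z_{-1})$, $u_0=(x_0,y_0,z_0)\in\mathbb R^{d_x}\times\mathbb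 R^{d_y}\times\mathbb R^{d_y}$, a vector $v_{-1}^x\in\mathbb R^{d_x}$ and two memory tables of points $w_{-1,i}^f$ ($i\in[n]$) and $w_{-1,j}^g$ ($j\in[m]$) in $\mathbb R^{d_x}\times\mathbb R^{d_y}\times\mathbb R^{d_y}$. At each time $k\ge -1$ draw $i_k\in[n]$ and $j_k\in[m]$ uniformly, all independent. For functions $\phi_l$ of $u=(x,y,z)$ put $$\mathcal M_f^k(\phi)=\phi_{i_k}(u_k)-\phi_{i_k}(w_{k,i_k}^f)+\tfrac1n\sum_{i=1}^n\phi_i(w_{k,i}^f),\qquad \mathcal M_g^k(\phi)=\phi_{j_k}(u_k)-\phi_{j_k}(w_{k,j_k}^g)+\tfrac1m\sum_{j=1}^m\phi_j(w_{k,j}^g),$$ and $$D_k^x=\mathcal M_f^k(\nabla_1F)-\mathcal M_g^k(\nabla_{12}^2G\,z),\quad v_k^y=\mathcal M_g^k(\nabla_2G),\quad v_k^z=\mathcal M_g^k(\nabla_{22}^2G\,z)-\mathcal M_f^k(\nabla_2F).$$ After the draw at time $k$ the entries $w^f_{k,i_k}$ and $w^g_{k,j_k}$ are replaced by $u_k$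 and the others are kept; this gives $w^f_{k+1}$, $w^g_{k+1}$. For $k=0,1,\dots$, $$v_k^x=(1-\rho)v_{k-1}^x+\rho D_{k-1}^x,\quad x_{k+1}=x_k-\alpha v_k^x,\quad y_{k+1}=y_k-\beta v_k^y,\quad z_{k+1}=z_k-\gamma v_k^z.$$ Then there are constants $c_1,c_2,c_3,c_4>0$, depending only on $L^f,L_1^g,L_2^g,C^f,\mu$, such that for every $R$ there is a constant $C>0$, depending only on these quantities and on $R$ (not on $n,m,d_x,d_y,K,\varepsilon$, nor on the functions), with the following properties for every problem as above. The function $H$ is differentiable. Let $H$ be bounded below, and let the input be such that $H(x_0)-\inf H$, $\|y_0-y^*(x_0)\|$, $\|z_0\|$, $\|v_{-1}^x\|$ and the distances of each component of $u_{-1}$ and of all memory entries $w_{-1,i}^f$, $w_{-1,j}^g$ from the corresponding component of $u_0$ are at most $R$. Run MA-SABA with $$\alpha=c_1(n+m)^{-2/3},\quad \beta=c_2(n+m)^{-2/3},\quad \gamma=c_3(n+m)^{-2/3},\quad \rho=c_4(n+m)^{-2/3}.$$ (i) For every $K>1$, $$\frac1K\sum_{k=0}^{K-1}\mathbb E\|\nabla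 H(x_k)\|^2\le C\,\frac{(n+m)^{2/3}}{K}.$$ (ii) For every $0<\varepsilon\le (n+m)^{2/3}$ there is $K>1$ such that $\frac1K\sum_{k=0}^{K-1}\mathbb E\|\nabla H(x_k)\|^2\le\varepsilon$ and such that the number of calls to component gradients and Hessian- or Jacobian-vector products made up to the end of iteration $K-1$ (five per time step $k=-1,\dots,K-1$, answers at memory points being stored) is at most $C(n+m)^{2/3}\varepsilon^{-1}$, in addition to the $2n+3m$ calls that fill the initial memory tables. -/

import Mathlib

open MeasureTheory ProbabilityTheory
open scoped NNReal ENNReal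

noncomputable section

/-- `ℝ^d` with the Euclidean norm. -/
abbrev Vec (d : ℕ) := EuclideanSpace ℝ (Fin d)

/-- `ℝ^{dx} × ℝ^{dy}` with the Euclidean norm of `ℝ^{dx + dy}`. -/
abbrev Joint (dx dy : ℕ) := WithLp 2 (Vec dx × Vec dy)

variable {dx dy n m : ℕ}

/-- The pair `(x, y)`. -/
def joint (x : Vec dx) (y : Vec dy) : Joint dx dy := WithLp.toLp 2 (x, y)

/-- `∇₁ φ (p)`: the `x`-component of the gradient. -/
def grad1 (φ : Joint dx dy → ℝ) (p : Joint dx dy) : Vec dx := (gradient φ p).fst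

/-- `∇₂ φ (p)`: the `y`-component of the gradient. -/
def grad2 (φ : Joint dx dy → ℝ) (p : Joint dx dy) : Vec dy := (gradient φ p).snd

/-- The full Hessian `∇² φ (p)` (the derivative of the gradient) as a linear operator, carrying the
operator norm. -/
def hess {E : Type*} [NormedAddCommGroup E] [InnerProductSpace ℝ E] [CompleteSpace E]
    (φ : E → ℝ) (p : E) : E →L[ℝ] E :=
  fderiv ℝ (gradient φ) p

/-- `∇²₁₂ φ (p) z`: the upper right block of the Hessian applied to `z`. -/
def hess12 (φ : Joint dx dy → ℝ) (p : Joint dx dy) (z : Vec dy) : Vec dx :=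
  (hess φ p (joint 0 z)).fst

/-- `∇²₂₂ φ (p) z`: the lower right block of the Hessian applied to `z`. -/
def hess22 (φ : Joint dx dy → ℝ) (p : Joint dx dy) (z : Vec dy) : Vec dy :=
  (hess φ p (joint 0 z)).snd

/-- The data of a finite-sum bilevel problem: upper-level components `F i`, `i ∈ [n]`, and
lower-level components `G j`, `j ∈ [m]`. -/
structure FiniteSumBilevel (dx dy n m : ℕ) where
  F : Fin n → Joint dx dy → ℝ
  G : Fin m → Joint dx dy → ℝ

namespace FiniteSumBilevel

/-- Upper-level objective `f = (1/n) ∑ F i`. -/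
def f (B : FiniteSumBilevel dx dy n m) (p : Joint dx dy) : ℝ := (1 / (n : ℝ)) * ∑ i, B.F i p

/-- Lower-level objective `g = (1/m) ∑ G j`. -/
def g (B : FiniteSumBilevel dx dy n m) (p : Joint dx dy) : ℝ := (1 / (m : ℝ)) * ∑ j, B.G j p

/-- `y*(x)`, a minimizer of `g(x, ·)` (it exists and is unique when `g(x, ·)` is continuous and
strongly convex). -/
def yStar (B : FiniteSumBilevel dx dy n m) (x : Vec dx) : Vec dy :=
  Classical.epsilon fun y => ∀ y', B.g (joint x y) ≤ B.g (joint x y')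

/-- `H(x) = f(x, y*(x))`. -/
def H (B : FiniteSumBilevel dx dy n m) (x : Vec dx) : ℝ := B.f (joint x (B.yStar x))

/-- The standing assumptions: smoothness of the upper level, smoothness and strong convexity of
the lower level, and smoothness of each of the components. -/
structure Assumptions (B : FiniteSumBilevel dx dy n m) (Lf Lg1 Lg2 : ℝ≥0) (Cf μ : ℝ) :
    Prop where
  contDiff_F : ∀ i, ContDiff ℝ 1 (B.F i)
  contDiff_G : ∀ j, ContDiff ℝ 2 (B.G j)
  lipschitz_grad_f : LipschitzWith Lf (gradient B.f)
  bound_grad2_f : ∀ x, ‖grad2 B.f (joint x (B.yStar x))‖ ≤ Cf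
  lipschitz_grad_g : LipschitzWith Lg1 (gradient B.g)
  lipschitz_hess_g : LipschitzWith Lg2 (hess B.g)
  strongConvex_g : ∀ x, StrongConvexOn Set.univ μ (fun y => B.g (joint x y))
  lipschitz_grad_F : ∀ i, LipschitzWith Lf (gradient (B.F i))
  lipschitz_grad_G : ∀ j, LipschitzWith Lg1 (gradient (B.G j))
  lipschitz_hess_G : ∀ j, LipschitzWith Lg2 (hess (B.G j))

end FiniteSumBilevel

/-- A triple `u = (x, y, z)`. -/
structure Triple (dx dy : ℕ) where
  x : Vec dx
  y : Vec dy
  z : Vec dy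

/-- All three components of `u` and `u'` are within distance `R`. -/
def Triple.Within (u u' : Triple dx dy) (R : ℝ) : Prop :=
  ‖u.x - u'.x‖ ≤ R ∧ ‖u.y - u'.y‖ ≤ R ∧ ‖u.z - u'.z‖ ≤ R

/-- The SAGA estimator
`φ_i(u) - φ_i(w_i) + (1/N) ∑_l φ_l(w_l)` of `(1/N) ∑_l φ_l(u)`, for the drawn index `i`. -/
def saga {N : ℕ} {E : Type*} [AddCommGroup E] [Module ℝ E] (φ : Fin N → Triple dx dy → E)
    (w : Fin N → Triple dx dy) (u : Triple dx dy) (i : Fin N) : E :=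
  φ i u - φ i (w i) + (1 / (N : ℝ)) • ∑ l, φ l (w l)

/-- The two memory tables: `f i` is the memory of the component `F i`, `g j` that of `G j`. -/
structure Memory (dx dy n m : ℕ) where
  f : Fin n → Triple dx dy
  g : Fin m → Triple dx dy

/-- Overwrite the entries of the drawn indices `s = (i, j)` by the current point `u`. -/
def Memory.update (w : Memory dx dy n m) (s : Fin n × Fin m) (u : Triple dx dy) :
    Memory dx dy n m where
  f := Function.update w.f s.1 u
  g := Function.update w.g s.2 u

namespace FiniteSumBilevel

variable (B : FiniteSumBilevel dx dy n m)

/-- SAGA estimator of `D_x(u) = ∇₁ f(x,y) - ∇²₁₂ g(x,y) z`. -/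
def estX (w : Memory dx dy n m) (u : Triple dx dy) (s : Fin n × Fin m) : Vec dx :=
  saga (fun i u => grad1 (B.F i) (joint u.x u.y)) w.f u s.1
    - saga (fun j u => hess12 (B.G j) (joint u.x u.y) u.z) w.g u s.2

/-- SAGA estimator of `D_y(u) = ∇₂ g(x,y)`. -/
def estY (w : Memory dx dy n m) (u : Triple dx dy) (s : Fin n × Fin m) : Vec dy :=
  saga (fun j u => grad2 (B.G j) (joint u.x u.y)) w.g u s.2

/-- SAGA estimator of `D_z(u) = ∇²₂₂ g(x,y) z - ∇₂ f(x,y)`. -/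
def estZ (w : Memory dx dy n m) (u : Triple dx dy) (s : Fin n × Fin m) : Vec dy :=
  saga (fun j u => hess22 (B.G j) (joint u.x u.y) u.z) w.g u s.2
    - saga (fun i u => grad2 (B.F i) (joint u.x u.y)) w.f u s.1

end FiniteSumBilevel

/-- Constant step sizes `α, β, γ` and momentum parameter `ρ`. -/
structure Params where
  α : ℝ
  β : ℝ
  γ : ℝ
  ρ : ℝ

/-- The input of MA-SABA: the points `u₋₁` and `u₀`, the direction `v₋₁` and the initial memory
tables `w₋₁`. -/
structure Init (dx dy n m : ℕ) where
  uPrev : Triple dx dy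
  u0 : Triple dx dy
  vPrev : Vec dx
  w : Memory dx dy n m

/-- The initialization is controlled by `R`: the initial optimality gap `H(x₀) - inf H` (so in
particular `H` is bounded below), the lower-level error, and the sizes of the other inputs. -/
structure Init.BoundedBy (I : Init dx dy n m) (B : FiniteSumBilevel dx dy n m) (R : ℝ) :
    Prop where
  gap : ∀ x, B.H I.u0.x - B.H x ≤ R
  lower : ‖I.u0.y - B.yStar I.u0.x‖ ≤ R
  z0 : ‖I.u0.z‖ ≤ R
  vPrev : ‖I.vPrev‖ ≤ R
  uPrev : I.uPrev.Within I.u0 R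
  memf : ∀ i, (I.w.f i).Within I.u0 R
  memg : ∀ j, (I.w.g j).Within I.u0 R

/-- The state of MA-SABA at the start of iteration `k`: the point `u_k`, the direction
`v^x_{k-1}`, the estimate `D^x_{k-1}`, the memory tables `w_k`, and the number of oracle calls
(component gradients and Hessian- or Jacobian-vector products) made so far. -/
structure State (dx dy n m : ℕ) where
  u : Triple dx dy
  v : Vec dx
  D : Vec dx
  w : Memory dx dy n m
  calls : ℕ

namespace FiniteSumBilevel

variable (B : FiniteSumBilevel dx dy n m)

/-- The state at the start of iteration `0`: the estimate `D^x_{-1}` is formed at `u₋₁` with the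
indices `s` drawn at time `-1`, and the tables are updated.
Filling the tables takes two calls (`∇₁ F i`, `∇₂ F i`) per `i ∈ [n]` and three calls
(`∇₂ G j`, `∇²₁₂ G j z`, `∇²₂₂ G j z`) per `j ∈ [m]`; the five calls at the point `u₋₁` follow. -/
def start (I : Init dx dy n m) (s : Fin n × Fin m) : State dx dy n m where
  u := I.u0
  v := I.vPrev
  D := B.estX I.w I.uPrev s
  w := I.w.update s I.uPrev
  calls := (2 * n + 3 * m) + 5

/-- Iteration `k` of MA-SABA with drawn indices `s = (i, j)`.
It makes the five oracle calls `∇₁ F i`, `∇₂ F i`, `∇₂ G j`, `∇²₁₂ G j z`, `∇²₂₂ G j z` at the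
current point; the oracle answers at the memory points were obtained earlier and are stored. -/
def step (θ : Params) (S : State dx dy n m) (s : Fin n × Fin m) : State dx dy n m where
  u :=
    { x := S.u.x - θ.α • ((1 - θ.ρ) • S.v + θ.ρ • S.D)
      y := S.u.y - θ.β • B.estY S.w S.u s
      z := S.u.z - θ.γ • B.estZ S.w S.u s }
  v := (1 - θ.ρ) • S.v + θ.ρ • S.D
  D := B.estX S.w S.u s
  w := S.w.update s S.u
  calls := S.calls + 5

/-- `run θ I s k` is the state at the start of iteration `k` (that is, after `k` iterations) when
the indices drawn at the times `-1, 0, 1, …` are `s 0, s 1, s 2, …`. -/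
def run (θ : Params) (I : Init dx dy n m) (s : ℕ → Fin n × Fin m) : ℕ → State dx dy n m
  | 0 => B.start I (s 0)
  | k + 1 => B.step θ (run θ I s k) (s (k + 1))

/-- `(1/K) ∑_{k<K} 𝔼 ‖∇H(x_k)‖²`. -/
def avgSqGrad {Ω : Type*} [MeasurableSpace Ω] (P : Measure Ω) (θ : Params)
    (I : Init dx dy n m) (s : ℕ → Ω → Fin n × Fin m) (K : ℕ) : ℝ :=
  (1 / (K : ℝ)) * ∑ k ∈ Finset.range K,
    ∫ ω, ‖gradient B.H (B.run θ I (fun t => s t ω) k).u.x‖ ^ 2 ∂P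

end FiniteSumBilevel

/-- The index pairs drawn at different times are independent, and each pair is uniform on
`[n] × [m]` (that is, its two components are independent and uniform). -/
structure UniformSampling {Ω : Type*} [MeasurableSpace Ω] (P : Measure Ω)
    (s : ℕ → Ω → Fin n × Fin m) : Prop where
  measurable : ∀ t, Measurable (s t)
  indep : iIndepFun s P
  uniform : ∀ t a, P (s t ⁻¹' {a}) = ((n : ℝ≥0∞) * (m : ℝ≥0∞))⁻¹

/-- `α = c₁ (n+m)^{-2/3}`, `β = c₂ (n+m)^{-2/3}`, `γ = c₃ (n+m)^{-2/3}`, `ρ = c₄ (n+m)^{-2/3}`. -/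
def scaledParams (c₁ c₂ c₃ c₄ : ℝ) (n m : ℕ) : Params where
  α := c₁ * ((n : ℝ) + m) ^ (-(2 / 3) : ℝ)
  β := c₂ * ((n : ℝ) + m) ^ (-(2 / 3) : ℝ)
  γ := c₃ * ((n : ℝ) + m) ^ (-(2 / 3) : ℝ)
  ρ := c₄ * ((n : ℝ) + m) ^ (-(2 / 3) : ℝ)

end

/-! The proof is a Lyapunov argument. Put N = n + m and τ = N^(-2/3), let v be the momentum
direction, z*(x) the solution of ∇²₂₂g z = ∇₂f at (x, y*(x)), and E the mean squared distance from
the current point to the memory entries, added over the two tables. The potential is H(x) + κ (‖v -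
∇H(x)‖² + b ‖y - y*(x)‖² + c ‖z - z*(x)‖² + N τ² E), and all step sizes are constant multiples of τ.
One iteration lowers its mean by at least (α/2) ‖∇H(x)‖² (`mean_lyapunov_step_le`). Its initial gap
is bounded in terms of R and the problem constants (`lyapunov_start_le`), so telescoping gives (i),
and (ii) is a choice of K.

Analytic input: strong convexity makes y* and z* Lipschitz, and the adjoint vector z* expands H to
first order with a quadratic remainder (`abs_H_sub_le`). This yields differentiability of H, its
gradient and the descent inequality.

Stochastic input: the SAGA estimators are unbiased, with variance at most a constant times E + ‖z -
z*‖². The second term appears because z is not confined to a bounded set.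

The exponent 2/3 comes from `memory_recursion`, which separates noise from drift. A table forgets a
fraction of order 1/N of its error per iteration; the squared step, of order τ², enters with an
absolute factor, and its mean part also with a factor of order N. With weight W = N τ² the
forgetting is worth τ²/2 times E and absorbs the variances; the drift costs W N τ² = N² τ⁴ = τ, the
order of the contraction of the tracking errors. Both balances hold together because N² τ³ = 1. -/

noncomputable section

variable {dx dy n m : ℕ}

/-! ### Norm inequalities and averages over finite families -/

section Generic

lemma norm_add_sq_le_two {W : Type*} [NormedAddCommGroup W] (a b : W) :
    ‖a + b‖ ^ 2 ≤ 2 * ‖a‖ ^ 2 + 2 * ‖b‖ ^ 2 := by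
  nlinarith [norm_add_le a b, norm_nonneg (a + b), norm_nonneg a, norm_nonneg b,
    sq_nonneg (‖a‖ - ‖b‖)]

lemma norm_sub_sq_le_two {W : Type*} [NormedAddCommGroup W] (a b : W) :
    ‖a - b‖ ^ 2 ≤ 2 * ‖a‖ ^ 2 + 2 * ‖b‖ ^ 2 := by
  simpa [sub_eq_add_neg] using norm_add_sq_le_two a (-b)

variable {E : Type*} [NormedAddCommGroup E] [InnerProductSpace ℝ E]

lemma two_inner_le (t : ℝ) (ht : 0 < t) (a b : E) :
    2 * inner ℝ a b ≤ t * ‖a‖ ^ 2 + t⁻¹ * ‖b‖ ^ 2 := by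
  have h1 := real_inner_le_norm a b
  have h2 : 0 ≤ t * (‖a‖ - t⁻¹ * ‖b‖) ^ 2 := by positivity
  have h3 : t * (‖a‖ - t⁻¹ * ‖b‖) ^ 2 = t * ‖a‖ ^ 2 - 2 * ‖a‖ * ‖b‖ + t⁻¹ * ‖b‖ ^ 2 := by
    field_simp
    ring
  nlinarith

lemma norm_add_sq_le_young (t : ℝ) (ht : 0 < t) (a b : E) :
    ‖a + b‖ ^ 2 ≤ (1 + t) * ‖a‖ ^ 2 + (1 + t⁻¹) * ‖b‖ ^ 2 := by
  rw [norm_add_sq_real]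
  linarith [two_inner_le t ht a b]

lemma norm_convex_comb_sq_le (r : ℝ) (h0 : 0 ≤ r) (h1 : r ≤ 1) (a b : E) :
    ‖(1 - r) • a + r • b‖ ^ 2 ≤ (1 - r) * ‖a‖ ^ 2 + r * ‖b‖ ^ 2 := by
  have h : (1 - r) * ‖a‖ ^ 2 + r * ‖b‖ ^ 2 - ‖(1 - r) • a + r • b‖ ^ 2
      = (r * (1 - r)) * ‖a - b‖ ^ 2 := by
    rw [norm_add_sq_real, norm_sub_sq_real, norm_smul, norm_smul, inner_smul_left,
      inner_smul_right, mul_pow, mul_pow]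
    simp only [Real.norm_eq_abs, sq_abs, conj_trivial]
    ring
  nlinarith [mul_nonneg (mul_nonneg h0 (sub_nonneg.2 h1)) (sq_nonneg ‖a - b‖)]

/-- The average of a finite family. -/
def mean {ι V : Type*} [Fintype ι] [AddCommGroup V] [Module ℝ V] (f : ι → V) : V :=
  (1 / (Fintype.card ι : ℝ)) • ∑ i, f i

section Mean

variable {ι V : Type*} [Fintype ι] [AddCommGroup V] [Module ℝ V]

lemma mean_add (f g : ι → V) : mean (fun i => f i + g i) = mean f + mean g := by
  simp [mean, Finset.sum_add_distrib]

lemma mean_sub (f g : ι → V) : mean (fun i => f i - g i) = mean f - mean g := by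
  simp [mean, Finset.sum_sub_distrib, smul_sub]

lemma mean_smul (c : ℝ) (f : ι → V) : mean (fun i => c • f i) = c • mean f := by
  simp only [mean, ← Finset.smul_sum]
  rw [smul_comm]

lemma mean_mul (c : ℝ) (f : ι → ℝ) : mean (fun i => c * f i) = c * mean f := mean_smul c f

lemma mean_const [Nonempty ι] (c : V) : mean (fun _ : ι => c) = c := by
  simp only [mean, Finset.sum_const, Finset.card_univ]
  rw [← Nat.cast_smul_eq_nsmul ℝ, smul_smul, one_div_mul_cancel, one_smul]
  exact_mod_cast Fintype.card_ne_zero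

lemma mean_mono {f g : ι → ℝ} (h : ∀ i, f i ≤ g i) : mean f ≤ mean g := by
  simp only [mean, smul_eq_mul]
  gcongr
  exact h _

lemma mean_nonneg {f : ι → ℝ} (h : ∀ i, 0 ≤ f i) : 0 ≤ mean f := by
  simp only [mean, smul_eq_mul]
  exact mul_nonneg (by positivity) (Finset.sum_nonneg fun i _ => h i)

lemma mean_prod_fst {κ : Type*} [Fintype κ] [Nonempty κ] (f : ι → V) :
    mean (fun s : ι × κ => f s.1) = mean f := by
  have h : (Fintype.card κ : ℝ) ≠ 0 := by exact_mod_cast Fintype.card_ne_zero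
  simp only [mean, Fintype.sum_prod_type, Finset.sum_const, Finset.card_univ, Fintype.card_prod,
    ← Finset.smul_sum]
  rw [← Nat.cast_smul_eq_nsmul ℝ, smul_smul]
  congr 1
  push_cast
  field_simp

lemma mean_prod_snd {κ : Type*} [Fintype κ] [Nonempty ι] (f : κ → V) :
    mean (fun s : ι × κ => f s.2) = mean f := by
  have h : (Fintype.card ι : ℝ) ≠ 0 := by exact_mod_cast Fintype.card_ne_zero
  simp only [mean, Fintype.sum_prod_type, Finset.sum_const, Finset.card_univ, Fintype.card_prod]
  rw [← Nat.cast_smul_eq_nsmul ℝ, smul_smul]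
  congr 1
  push_cast
  field_simp

lemma inner_mean_right (a : E) (f : ι → E) :
    inner ℝ a (mean f) = mean fun i => inner ℝ a (f i) := by
  simp [mean, inner_smul_right, inner_sum]

lemma inner_mean_left (a : E) (f : ι → E) : inner ℝ (mean f) a = mean fun i => inner ℝ (f i) a := by
  simp [mean, inner_smul_left, sum_inner]

/-- Bias-variance decomposition: the deviations from the mean average to zero, so the cross term
disappears. -/
lemma mean_norm_add_smul_sq [Nonempty ι] (c : E) (t : ℝ) (X : ι → E) :
    mean (fun i => ‖c + t • X i‖ ^ 2)
      = ‖c + t • mean X‖ ^ 2 + t ^ 2 * mean (fun i => ‖X i - mean X‖ ^ 2) := by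
  have h : ∀ i, ‖c + t • X i‖ ^ 2 = ‖c + t • mean X‖ ^ 2
      + (2 * t * inner ℝ (c + t • mean X) (X i - mean X) + t ^ 2 * ‖X i - mean X‖ ^ 2) := by
    intro i
    have : c + t • X i = (c + t • mean X) + t • (X i - mean X) := by
      rw [smul_sub]; abel
    rw [this, norm_add_sq_real, inner_smul_right, norm_smul, mul_pow, Real.norm_eq_abs, sq_abs]
    ring
  simp_rw [h]
  rw [mean_add, mean_add, mean_const, mean_mul, mean_mul, ← inner_mean_right, mean_sub, mean_const]
  simp

lemma mean_norm_sq [Nonempty ι] (X : ι → E) :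
    mean (fun i => ‖X i‖ ^ 2) = ‖mean X‖ ^ 2 + mean (fun i => ‖X i - mean X‖ ^ 2) := by
  simpa using mean_norm_add_smul_sq 0 1 X

lemma norm_mean_sq_le [Nonempty ι] (X : ι → E) : ‖mean X‖ ^ 2 ≤ mean fun i => ‖X i‖ ^ 2 := by
  have := mean_norm_sq X
  have h : 0 ≤ mean (fun i => ‖X i - mean X‖ ^ 2) := mean_nonneg fun i => by positivity
  linarith

lemma mean_norm_sub_mean_sq_le [Nonempty ι] (X : ι → E) :
    mean (fun i => ‖X i - mean X‖ ^ 2) ≤ mean fun i => ‖X i‖ ^ 2 := by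
  have := mean_norm_sq X
  nlinarith [sq_nonneg ‖mean X‖]

/-- One step of the expected squared distance between the iterate and a memory table: `e i` is the
old displacement of the entry `i`, `δ s` the move of the iterate, and the entry `q s` is refreshed.
The noise of `δ` enters with a factor independent of the size of the table. -/
lemma memory_recursion [DecidableEq ι] [Nonempty ι] {σ : Type*} [Fintype σ] [Nonempty σ]
    (q : σ → ι) (hq : ∀ h : ι → ℝ, mean (fun s => h (q s)) = mean h) (e : ι → E) (δ : σ → E) :
    mean (fun s => mean fun i => ‖δ s + if i = q s then 0 else e i‖ ^ 2)
      ≤ (1 - 1 / (2 * Fintype.card ι)) * mean (fun i => ‖e i‖ ^ 2)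
        + 5 * mean (fun s => ‖δ s‖ ^ 2) + 4 * Fintype.card ι * ‖mean δ‖ ^ 2 := by
  set N : ℝ := (Fintype.card ι : ℝ) with hN
  have hN1 : 1 ≤ N := by rw [hN]; exact_mod_cast Fintype.card_pos
  have key : ∀ s, mean (fun i => ‖δ s + if i = q s then 0 else e i‖ ^ 2)
      = ‖δ s‖ ^ 2 + 2 * inner ℝ (δ s) (mean e) + mean (fun i => ‖e i‖ ^ 2)
        - (1 / N) * (2 * inner ℝ (δ s) (e (q s)) + ‖e (q s)‖ ^ 2) := by
    intro s
    have : ∀ i, ‖δ s + if i = q s then 0 else e i‖ ^ 2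
        = ‖δ s‖ ^ 2 + 2 * inner ℝ (δ s) (e i) + ‖e i‖ ^ 2
          - if i = q s then 2 * inner ℝ (δ s) (e i) + ‖e i‖ ^ 2 else 0 := by
      intro i
      split_ifs
      · simp
      · rw [norm_add_sq_real]; ring
    simp_rw [this]
    rw [mean_sub, mean_add, mean_add, mean_const, mean_mul, ← inner_mean_right]
    congr 1
    simp [mean, hN]
  -- This cross term already carries the factor 1/N of a single entry, so Young with an absolute
  -- weight suffices. The weight 4 keeps 3/4 of the contraction produced by the refresh.
  have cross : ∀ s, -(2 * inner ℝ (δ s) (e (q s))) ≤ 4 * ‖δ s‖ ^ 2 + 1 / 4 * ‖e (q s)‖ ^ 2 := by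
    intro s
    have := two_inner_le 4 (by norm_num) (-δ s) (e (q s))
    rw [inner_neg_left, norm_neg] at this
    linarith
  have h1 : mean (fun s => mean fun i => ‖δ s + if i = q s then 0 else e i‖ ^ 2)
      ≤ mean fun s => ((1 + 4 / N) * ‖δ s‖ ^ 2 + 2 * inner ℝ (δ s) (mean e)
        + mean (fun i => ‖e i‖ ^ 2)) - (3 / (4 * N)) * ‖e (q s)‖ ^ 2 := by
    refine mean_mono fun s => ?_
    rw [key s]
    have : (1 / N) * (-(2 * inner ℝ (δ s) (e (q s))))
        ≤ (1 / N) * (4 * ‖δ s‖ ^ 2 + 1 / 4 * ‖e (q s)‖ ^ 2) :=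
      mul_le_mul_of_nonneg_left (cross s) (by positivity)
    have e1 : (3 / (4 * N)) * ‖e (q s)‖ ^ 2
        = (1 / N) * ‖e (q s)‖ ^ 2 - (1 / N) * (1 / 4 * ‖e (q s)‖ ^ 2) := by
      field_simp; ring
    have e2 : (1 + 4 / N) * ‖δ s‖ ^ 2 = ‖δ s‖ ^ 2 + (1 / N) * (4 * ‖δ s‖ ^ 2) := by field_simp
    rw [e1, e2]
    linarith
  rw [mean_sub, mean_add, mean_add, mean_mul, mean_mul, mean_mul, mean_const, ← inner_mean_left,
    hq (fun i => ‖e i‖ ^ 2)] at h1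
  -- The remaining cross term is linear in `δ`, so it is averaged before Young is applied and only
  -- the drift `mean δ` pays the factor N. The weight 4N costs 1/(4N) of the contraction, which goes
  -- from 3/(4N) to 1/(2N).
  have h2 := two_inner_le (4 * N) (by positivity) (mean δ) (mean e)
  have h3 : (4 * N)⁻¹ * ‖mean e‖ ^ 2 ≤ (4 * N)⁻¹ * mean fun i => ‖e i‖ ^ 2 :=
    mul_le_mul_of_nonneg_left (norm_mean_sq_le e) (by positivity)
  have h4 : (1 + 4 / N) * mean (fun s => ‖δ s‖ ^ 2) ≤ 5 * mean (fun s => ‖δ s‖ ^ 2) := by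
    refine mul_le_mul_of_nonneg_right ?_ (mean_nonneg fun s => by positivity)
    have : 4 / N ≤ 4 := div_le_self (by norm_num) hN1
    linarith
  have e3 : (1 - 1 / (2 * N)) * mean (fun i => ‖e i‖ ^ 2) = mean (fun i => ‖e i‖ ^ 2)
      + (4 * N)⁻¹ * mean (fun i => ‖e i‖ ^ 2) - 3 / (4 * N) * mean (fun i => ‖e i‖ ^ 2) := by
    field_simp; ring
  rw [e3]
  linarith

end Mean

/-! ### Strong convexity and Taylor bounds -/

/-- First-order lower bound for strongly convex functions. -/
lemma StrongConvexOn.add_inner_le [CompleteSpace E] {φ : E → ℝ} {μ : ℝ}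
    (h : StrongConvexOn Set.univ μ φ) {y v : E} (hv : HasGradientAt φ v y) (y' : E) :
    φ y + inner ℝ v (y' - y) + μ / 2 * ‖y' - y‖ ^ 2 ≤ φ y' := by
  have hd : HasDerivAt (fun t : ℝ => φ (y + t • (y' - y))) (inner ℝ v (y' - y)) 0 := by
    have h1 : HasDerivAt (fun t : ℝ => y + t • (y' - y)) (y' - y) 0 := by
      simpa using ((hasDerivAt_id (0 : ℝ)).smul_const (y' - y)).const_add y
    have h2 : HasFDerivAt φ (InnerProductSpace.toDual ℝ E v) (y + (0 : ℝ) • (y' - y)) := by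
      simpa using hv.hasFDerivAt
    exact h2.comp_hasDerivAt (0 : ℝ) h1
  have hs := hd.tendsto_slope_zero_right
  have hr : Filter.Tendsto (fun t : ℝ => φ y' - φ y - (1 - t) * (μ / 2 * ‖y' - y‖ ^ 2))
      (nhdsWithin 0 (Set.Ioi 0)) (nhds (φ y' - φ y - (1 - 0) * (μ / 2 * ‖y' - y‖ ^ 2))) := by
    refine Filter.Tendsto.mono_left (Continuous.tendsto ?_ 0) nhdsWithin_le_nhds
    fun_prop
  -- Strong convexity on the segment bounds the difference quotient at t > 0 with the factor 1 - t
  -- on the quadratic term; letting t tend to 0 recovers the full modulus.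
  have hle := le_of_tendsto_of_tendsto hs hr ?_
  · linarith
  · filter_upwards [Ioo_mem_nhdsGT (zero_lt_one' ℝ)] with t ht
    have := h.2 (Set.mem_univ y) (Set.mem_univ y') (sub_nonneg.2 ht.2.le) ht.1.le (by ring)
    have e : (1 - t) • y + t • y' = y + t • (y' - y) := by
      rw [sub_smul, smul_sub, one_smul]; abel
    rw [e, norm_sub_rev y y'] at this
    simp only [smul_eq_mul, zero_add, zero_smul, add_zero] at this ⊢
    rw [inv_mul_le_iff₀ ht.1]
    nlinarith

lemma StrongConvexOn.monotone_gradient [CompleteSpace E] {φ : E → ℝ} {μ : ℝ}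
    (h : StrongConvexOn Set.univ μ φ) {y v y' v' : E} (hv : HasGradientAt φ v y)
    (hv' : HasGradientAt φ v' y') : μ * ‖y - y'‖ ^ 2 ≤ inner ℝ (v - v') (y - y') := by
  have h1 := h.add_inner_le hv y'
  have h2 := h.add_inner_le hv' y
  rw [norm_sub_rev] at h1
  have e : inner ℝ v (y' - y) = - inner ℝ v (y - y') := by rw [← inner_neg_right, neg_sub]
  rw [inner_sub_left]
  linarith

/-- A differentiable strongly convex function on a finite-dimensional space has a minimizer. -/
lemma StrongConvexOn.exists_forall_le [CompleteSpace E] [FiniteDimensional ℝ E] {φ : E → ℝ} {μ : ℝ}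
    (hμ : 0 < μ) (h : StrongConvexOn Set.univ μ φ) (hd : Differentiable ℝ φ) :
    ∃ y, ∀ y', φ y ≤ φ y' := by
  have : ProperSpace E := FiniteDimensional.proper ℝ E
  refine hd.continuous.exists_forall_le ?_
  have hg := (hd 0).hasGradientAt
  -- The first-order bound at 0 gives quadratic growth, hence coercivity.
  have hb : ∀ y, ‖y‖ * (μ / 2 * ‖y‖ - ‖gradient φ 0‖) + φ 0 ≤ φ y := by
    intro y
    have := h.add_inner_le hg y
    rw [sub_zero] at this
    have h2 := abs_le.1 (abs_real_inner_le_norm (gradient φ 0) y)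
    nlinarith [h2.1]
  refine Filter.tendsto_atTop_mono hb ?_
  have hn := tendsto_norm_cocompact_atTop (E := E)
  refine Filter.tendsto_atTop_add_const_right _ _ (hn.atTop_mul_atTop₀ ?_)
  exact Filter.tendsto_atTop_add_const_right _ _ (hn.const_mul_atTop (by positivity))

/-- First-order Taylor bound for a map with Lipschitz derivative. -/
lemma norm_taylor_le {W : Type*} [NormedAddCommGroup W] [NormedSpace ℝ W] {ψ : E → W}
    {ψ' : E → E →L[ℝ] W} (hd : ∀ p, HasFDerivAt ψ (ψ' p) p) {K : ℝ}
    (hK : ∀ p q, ‖ψ' p - ψ' q‖ ≤ K * ‖p - q‖) (hK0 : 0 ≤ K) (p q : E) :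
    ‖ψ q - ψ p - ψ' p (q - p)‖ ≤ K * ‖q - p‖ ^ 2 := by
  -- On this ball the derivative differs from `ψ' p` by at most K ‖q - p‖, so the mean value
  -- inequality applies. It gives the constant K instead of K/2, which is harmless here.
  have := (convex_closedBall p ‖q - p‖).norm_image_sub_le_of_norm_hasFDerivWithin_le'
    (φ := ψ' p) (C := K * ‖q - p‖) (x := p) (y := q)
    (fun x _ => (hd x).hasFDerivWithinAt) (fun x hx => (hK x p).trans ?_)
    (Metric.mem_closedBall_self (norm_nonneg _)) (by simp [dist_eq_norm])
  · calc _ ≤ _ := this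
      _ = _ := by ring
  · rw [Metric.mem_closedBall, dist_eq_norm] at hx
    gcongr

end Generic

/-! ### The product space and partial gradients -/

section Joint

lemma norm_joint_sq (x : Vec dx) (y : Vec dy) : ‖joint x y‖ ^ 2 = ‖x‖ ^ 2 + ‖y‖ ^ 2 :=
  WithLp.prod_norm_sq_eq_of_L2 _

lemma joint_sub (x x' : Vec dx) (y y' : Vec dy) :
    joint x y - joint x' y' = joint (x - x') (y - y') := rfl

lemma norm_joint_zero_left (y : Vec dy) : ‖(joint 0 y : Joint dx dy)‖ = ‖y‖ := by
  have := norm_joint_sq (0 : Vec dx) y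
  rw [norm_zero] at this
  exact (sq_eq_sq₀ (norm_nonneg _) (norm_nonneg _)).1 (by linarith)

lemma norm_joint_zero_right (x : Vec dx) : ‖(joint x 0 : Joint dx dy)‖ = ‖x‖ := by
  have := norm_joint_sq x (0 : Vec dy)
  rw [norm_zero] at this
  exact (sq_eq_sq₀ (norm_nonneg _) (norm_nonneg _)).1 (by linarith)

lemma norm_joint_le (x : Vec dx) (y : Vec dy) : ‖joint x y‖ ≤ ‖x‖ + ‖y‖ := by
  have := norm_joint_sq x y
  exact abs_le_of_sq_le_sq' (by nlinarith [norm_nonneg x, norm_nonneg y]) (by positivity) |>.2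

lemma Joint.norm_fst_le (p : Joint dx dy) : ‖p.fst‖ ≤ ‖p‖ :=
  abs_le_of_sq_le_sq' (by
    rw [WithLp.prod_norm_sq_eq_of_L2 p]; nlinarith [sq_nonneg ‖p.snd‖]) (norm_nonneg _) |>.2

lemma Joint.norm_snd_le (p : Joint dx dy) : ‖p.snd‖ ≤ ‖p‖ :=
  abs_le_of_sq_le_sq' (by
    rw [WithLp.prod_norm_sq_eq_of_L2 p]; nlinarith [sq_nonneg ‖p.fst‖]) (norm_nonneg _) |>.2

lemma Joint.inner_eq (p q : Joint dx dy) :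
    inner ℝ p q = inner ℝ p.fst q.fst + inner ℝ p.snd q.snd :=
  WithLp.prod_inner_apply p q

lemma Joint.inner_joint_zero (p : Joint dx dy) (z : Vec dy) :
    inner ℝ p (joint 0 z) = inner ℝ p.snd z := by
  rw [Joint.inner_eq]
  simp [joint]

/-- The embedding `y ↦ (0, y)`. -/
def jointInr (dx dy : ℕ) : Vec dy →L[ℝ] Joint dx dy :=
  (WithLp.prodContinuousLinearEquiv 2 ℝ (Vec dx) (Vec dy)).symm.toContinuousLinearMap.comp
    (ContinuousLinearMap.inr ℝ (Vec dx) (Vec dy))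

@[simp] lemma jointInr_apply (y : Vec dy) : jointInr dx dy y = joint 0 y := rfl

lemma hasFDerivAt_joint (x : Vec dx) (y : Vec dy) :
    HasFDerivAt (fun y => joint x y) (jointInr dx dy) y := by
  have h : (fun y : Vec dy => joint x y) = fun y => jointInr dx dy y + joint x 0 := by
    funext y
    simp [joint, ← WithLp.toLp_add]
  rw [h]
  exact (jointInr dx dy).hasFDerivAt.add_const _

lemma hasGradientAt_joint {φ : Joint dx dy → ℝ} (hφ : Differentiable ℝ φ) (x : Vec dx)
    (y : Vec dy) : HasGradientAt (fun y => φ (joint x y)) (grad2 φ (joint x y)) y := by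
  rw [hasGradientAt_iff_hasFDerivAt]
  have h := (hφ (joint x y)).hasFDerivAt.comp y (hasFDerivAt_joint x y)
  refine h.congr_fderiv ?_
  ext b
  rw [ContinuousLinearMap.comp_apply, jointInr_apply, ← inner_gradient_left,
    Joint.inner_joint_zero]
  rfl

end Joint

/-! ### Hessians as operators, their symmetry and their averages -/

section Hessian

variable {E : Type*} [NormedAddCommGroup E] [InnerProductSpace ℝ E] [CompleteSpace E]

lemma gradient_eq_comp (φ : E → ℝ) :
    gradient φ = (InnerProductSpace.toDual ℝ E).symm ∘ fderiv ℝ φ := rfl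

lemma differentiable_gradient_of_contDiff {φ : E → ℝ} (hφ : ContDiff ℝ 2 φ) :
    Differentiable ℝ (gradient φ) := by
  have h : Differentiable ℝ (fderiv ℝ φ) :=
    (hφ.fderiv_right (m := 1) (by norm_num)).differentiable (by norm_num)
  rw [gradient_eq_comp]
  exact (InnerProductSpace.toDual ℝ E).symm.toContinuousLinearEquiv.differentiable.comp h

lemma hasFDerivAt_gradient_of_contDiff {φ : E → ℝ} (hφ : ContDiff ℝ 2 φ) (p : E) :
    HasFDerivAt (gradient φ) (hess φ p) p := (differentiable_gradient_of_contDiff hφ p).hasFDerivAt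

/-- Both sides are derivatives of the same scalar map q ↦ ⟨∇φ(q), b⟩ = Dφ(q) b, so uniqueness of the
derivative identifies them. Symmetry of the operator then follows from symmetry of the second
derivative. -/
lemma inner_hess_of_contDiff {φ : E → ℝ} (hφ : ContDiff ℝ 2 φ) (p a b : E) :
    inner ℝ (hess φ p a) b = fderiv ℝ (fderiv ℝ φ) p a b := by
  have h : Differentiable ℝ (fderiv ℝ φ) :=
    (hφ.fderiv_right (m := 1) (by norm_num)).differentiable (by norm_num)
  have h1 : HasFDerivAt (fun q => inner ℝ (gradient φ q) b)
      ((innerSL ℝ b).comp (hess φ p)) p := by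
    have := (innerSL ℝ b).hasFDerivAt.comp p (hasFDerivAt_gradient_of_contDiff hφ p)
    refine this.congr_of_eventuallyEq (Filter.Eventually.of_forall fun q => ?_)
    simp
  have h2 : HasFDerivAt (fun q => fderiv ℝ φ q b) ((fderiv ℝ (fderiv ℝ φ) p).flip b) p :=
    (by simpa using (h p).hasFDerivAt.clm_apply (hasFDerivAt_const b p))
  have h3 : (fun q => inner ℝ (gradient φ q) b) = fun q => fderiv ℝ φ q b := by
    funext q; rw [inner_gradient_left]
  rw [h3] at h1
  have := DFunLike.congr_fun (h1.unique h2) a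
  simpa [real_inner_comm] using this

lemma hess_symm_of_contDiff {φ : E → ℝ} (hφ : ContDiff ℝ 2 φ) (p a b : E) :
    inner ℝ (hess φ p a) b = inner ℝ a (hess φ p b) := by
  rw [real_inner_comm (hess φ p b) a, inner_hess_of_contDiff hφ, inner_hess_of_contDiff hφ]
  exact (hφ.contDiffAt.isSymmSndFDerivAt (by simp)).eq a b

end Hessian

lemma map_mean {ι V W : Type*} [Fintype ι] [AddCommGroup V] [Module ℝ V] [AddCommGroup W]
    [Module ℝ W] (A : V →ₗ[ℝ] W) (f : ι → V) : A (mean f) = mean fun i => A (f i) := by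
  simp [mean]

lemma hasFDerivAt_mean {ι V W : Type*} [Fintype ι] [NormedAddCommGroup V] [NormedSpace ℝ V]
    [NormedAddCommGroup W] [NormedSpace ℝ W] {ψ : ι → V → W} {ψ' : ι → V →L[ℝ] W} {p : V}
    (h : ∀ i, HasFDerivAt (ψ i) (ψ' i) p) :
    HasFDerivAt (fun q => mean fun i => ψ i q) (mean ψ') p :=
  (HasFDerivAt.fun_sum fun i _ => h i).const_smul _

lemma hess_apply_of_gradient_eq_mean {ι E : Type*} [Fintype ι] [NormedAddCommGroup E]
    [InnerProductSpace ℝ E] [CompleteSpace E] {φ : E → ℝ} {ψ : ι → E → ℝ}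
    (h : gradient φ = fun p => mean fun i => gradient (ψ i) p) (hψ : ∀ i, ContDiff ℝ 2 (ψ i))
    (p a : E) : hess φ p a = mean fun i => hess (ψ i) p a := by
  have h' : HasFDerivAt (gradient φ) (mean fun i => hess (ψ i) p) p := by
    rw [h]
    exact hasFDerivAt_mean fun i => hasFDerivAt_gradient_of_contDiff (hψ i) p
  rw [hess, h'.fderiv]
  simp [mean]

lemma Joint.mean_fst {ι : Type*} [Fintype ι] (f : ι → Joint dx dy) :
    (mean f).fst = mean fun i => (f i).fst :=
  map_mean ((LinearMap.fst ℝ (Vec dx) (Vec dy)).comp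
    (WithLp.linearEquiv 2 ℝ (Vec dx × Vec dy)).toLinearMap) f

lemma Joint.mean_snd {ι : Type*} [Fintype ι] (f : ι → Joint dx dy) :
    (mean f).snd = mean fun i => (f i).snd :=
  map_mean ((LinearMap.snd ℝ (Vec dx) (Vec dy)).comp
    (WithLp.linearEquiv 2 ℝ (Vec dx × Vec dy)).toLinearMap) f

lemma Joint.norm_grad1_sub_le {φ : Joint dx dy → ℝ} (p q : Joint dx dy) :
    ‖grad1 φ p - grad1 φ q‖ ≤ ‖gradient φ p - gradient φ q‖ :=
  Joint.norm_fst_le (gradient φ p - gradient φ q)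

lemma Joint.norm_grad2_sub_le {φ : Joint dx dy → ℝ} (p q : Joint dx dy) :
    ‖grad2 φ p - grad2 φ q‖ ≤ ‖gradient φ p - gradient φ q‖ :=
  Joint.norm_snd_le (gradient φ p - gradient φ q)

lemma hess12_sub (φ : Joint dx dy → ℝ) (p : Joint dx dy) (z z' : Vec dy) :
    hess12 φ p (z - z') = hess12 φ p z - hess12 φ p z' := by
  have : (joint 0 (z - z') : Joint dx dy) = joint 0 z - joint 0 z' := by
    rw [joint_sub, sub_zero]
  rw [hess12, this, map_sub]
  rfl

lemma hess22_sub (φ : Joint dx dy → ℝ) (p : Joint dx dy) (z z' : Vec dy) :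
    hess22 φ p (z - z') = hess22 φ p z - hess22 φ p z' := by
  have : (joint 0 (z - z') : Joint dx dy) = joint 0 z - joint 0 z' := by
    rw [joint_sub, sub_zero]
  rw [hess22, this, map_sub]
  rfl

lemma norm_hess12_le (φ : Joint dx dy → ℝ) (p : Joint dx dy) (z : Vec dy) :
    ‖hess12 φ p z‖ ≤ ‖hess φ p‖ * ‖z‖ := by
  rw [← norm_joint_zero_left (dx := dx) z]
  exact (Joint.norm_fst_le _).trans ((hess φ p).le_opNorm _)

lemma norm_hess22_le (φ : Joint dx dy → ℝ) (p : Joint dx dy) (z : Vec dy) :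
    ‖hess22 φ p z‖ ≤ ‖hess φ p‖ * ‖z‖ := by
  rw [← norm_joint_zero_left (dx := dx) z]
  exact (Joint.norm_snd_le _).trans ((hess φ p).le_opNorm _)

lemma norm_hess12_sub_le (φ : Joint dx dy → ℝ) (p q : Joint dx dy) (z : Vec dy) :
    ‖hess12 φ p z - hess12 φ q z‖ ≤ ‖hess φ p - hess φ q‖ * ‖z‖ := by
  rw [← norm_joint_zero_left (dx := dx) z]
  exact (Joint.norm_fst_le ((hess φ p - hess φ q) (joint 0 z))).trans
    ((hess φ p - hess φ q).le_opNorm _)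

lemma norm_hess22_sub_le (φ : Joint dx dy → ℝ) (p q : Joint dx dy) (z : Vec dy) :
    ‖hess22 φ p z - hess22 φ q z‖ ≤ ‖hess φ p - hess φ q‖ * ‖z‖ := by
  rw [← norm_joint_zero_left (dx := dx) z]
  exact (Joint.norm_snd_le ((hess φ p - hess φ q) (joint 0 z))).trans
    ((hess φ p - hess φ q).le_opNorm _)

/-! ### Regularity of y*, z* and the hypergradient -/

namespace FiniteSumBilevel

/-- The standing assumptions with a single constant `K` in place of all the constants and `K⁻¹` in
place of the modulus of strong convexity. -/
structure Regular (B : FiniteSumBilevel dx dy n m) (K : ℝ) : Prop where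
  one_le : 1 ≤ K
  n_pos : 0 < n
  m_pos : 0 < m
  diff_F : ∀ i, Differentiable ℝ (B.F i)
  contDiff_G : ∀ j, ContDiff ℝ 2 (B.G j)
  lip_F : ∀ i p q, ‖gradient (B.F i) p - gradient (B.F i) q‖ ≤ K * ‖p - q‖
  lip_f : ∀ p q, ‖gradient B.f p - gradient B.f q‖ ≤ K * ‖p - q‖
  lip_g : ∀ p q, ‖gradient B.g p - gradient B.g q‖ ≤ K * ‖p - q‖
  lip_G : ∀ j p q, ‖gradient (B.G j) p - gradient (B.G j) q‖ ≤ K * ‖p - q‖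
  lip_hess_g : ∀ p q, ‖hess B.g p - hess B.g q‖ ≤ K * ‖p - q‖
  lip_hess_G : ∀ j p q, ‖hess (B.G j) p - hess (B.G j) q‖ ≤ K * ‖p - q‖
  norm_hess_g : ∀ p, ‖hess B.g p‖ ≤ K
  norm_hess_G : ∀ j p, ‖hess (B.G j) p‖ ≤ K
  strong : ∀ x, StrongConvexOn Set.univ K⁻¹ (fun y => B.g (joint x y))
  bound : ∀ x, ‖grad2 B.f (joint x (B.yStar x))‖ ≤ K

lemma Assumptions.regular {B : FiniteSumBilevel dx dy n m} {Lf Lg1 Lg2 : ℝ≥0} {Cf μ : ℝ}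
    (h : B.Assumptions Lf Lg1 Lg2 Cf μ) (hn : 0 < n) (hm : 0 < m) (hCf : 0 < Cf) (hμ : 0 < μ) :
    B.Regular (1 + Lf + Lg1 + Lg2 + Cf + μ⁻¹) := by
  have hμ' : 0 < μ⁻¹ := inv_pos.2 hμ
  have h0 := Lf.coe_nonneg
  have h1 := Lg1.coe_nonneg
  have h2 := Lg2.coe_nonneg
  have hf : (Lf : ℝ) ≤ 1 + Lf + Lg1 + Lg2 + Cf + μ⁻¹ := by linarith
  have hg1 : (Lg1 : ℝ) ≤ 1 + Lf + Lg1 + Lg2 + Cf + μ⁻¹ := by linarith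
  have hg2 : (Lg2 : ℝ) ≤ 1 + Lf + Lg1 + Lg2 + Cf + μ⁻¹ := by linarith
  have lip : ∀ {V W : Type} [NormedAddCommGroup V] [NormedAddCommGroup W] {ψ : V → W} {l : ℝ≥0}
      {K : ℝ}, (l : ℝ) ≤ K → LipschitzWith l ψ → ∀ p q, ‖ψ p - ψ q‖ ≤ K * ‖p - q‖ := by
    intro V W _ _ ψ l K hl hψ p q
    have := hψ.dist_le_mul p q
    rw [dist_eq_norm, dist_eq_norm] at this
    exact this.trans (by gcongr)
  exact
  { one_le := by linarith
    n_pos := hn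
    m_pos := hm
    diff_F := fun i => (h.contDiff_F i).differentiable (by norm_num)
    contDiff_G := h.contDiff_G
    lip_F := fun i => lip hf (h.lipschitz_grad_F i)
    lip_f := lip hf h.lipschitz_grad_f
    lip_g := lip hg1 h.lipschitz_grad_g
    lip_G := fun j => lip hg1 (h.lipschitz_grad_G j)
    lip_hess_g := lip hg2 h.lipschitz_hess_g
    lip_hess_G := fun j => lip hg2 (h.lipschitz_hess_G j)
    norm_hess_g := fun p => (norm_fderiv_le_of_lipschitz ℝ h.lipschitz_grad_g).trans hg1
    norm_hess_G := fun j p => (norm_fderiv_le_of_lipschitz ℝ (h.lipschitz_grad_G j)).trans hg1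
    strong := fun x => (h.strongConvex_g x).mono (by
      rw [inv_le_comm₀ (by linarith) hμ]; linarith)
    bound := fun x => (h.bound_grad2_f x).trans (by linarith) }

/-- `z*(x)`: the solution of the linear system `∇²₂₂ g z = ∇₂ f` at `(x, y*(x))`. -/
def zStar (B : FiniteSumBilevel dx dy n m) (x : Vec dx) : Vec dy :=
  Classical.epsilon fun z =>
    hess22 B.g (joint x (B.yStar x)) z = grad2 B.f (joint x (B.yStar x))

/-- The hypergradient `∇₁ f - ∇²₁₂ g z*(x)` at `(x, y*(x))`. -/
def hyperGrad (B : FiniteSumBilevel dx dy n m) (x : Vec dx) : Vec dx :=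
  grad1 B.f (joint x (B.yStar x)) - hess12 B.g (joint x (B.yStar x)) (B.zStar x)

variable {B : FiniteSumBilevel dx dy n m}

namespace Regular

variable {K : ℝ} (hB : B.Regular K)
include hB

lemma pos : 0 < K := by linarith [hB.one_le]

lemma hasGradientAt_f (p : Joint dx dy) :
    HasGradientAt B.f (mean fun i => gradient (B.F i) p) p := by
  have h : HasFDerivAt B.f ((1 / (n : ℝ)) • ∑ i, fderiv ℝ (B.F i) p) p :=
    (HasFDerivAt.fun_sum fun i _ => (hB.diff_F i p).hasFDerivAt).const_smul (1 / (n : ℝ))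
  rw [hasGradientAt_iff_hasFDerivAt]
  refine h.congr_fderiv ?_
  ext b
  simp [mean]

lemma gradient_f (p : Joint dx dy) : gradient B.f p = mean fun i => gradient (B.F i) p :=
  (hB.hasGradientAt_f p).gradient

lemma contDiff_g : ContDiff ℝ 2 B.g :=
  contDiff_const.mul (ContDiff.sum fun j _ => hB.contDiff_G j)

lemma gradient_g : gradient B.g = fun p => mean fun j => gradient (B.G j) p := by
  funext p
  have h : HasFDerivAt B.g ((1 / (m : ℝ)) • ∑ j, fderiv ℝ (B.G j) p) p :=
    (HasFDerivAt.fun_sum fun j _ => (((hB.contDiff_G j).differentiable (by norm_num))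
      p).hasFDerivAt).const_smul (1 / (m : ℝ))
  refine HasGradientAt.gradient ?_
  rw [hasGradientAt_iff_hasFDerivAt]
  refine h.congr_fderiv ?_
  ext b
  simp [mean]

lemma hess_g (p a : Joint dx dy) : hess B.g p a = mean fun j => hess (B.G j) p a := by
  exact hess_apply_of_gradient_eq_mean hB.gradient_g hB.contDiff_G p a

lemma mean_grad1_F (p : Joint dx dy) : mean (fun i => grad1 (B.F i) p) = grad1 B.f p := by
  simp only [grad1, hB.gradient_f]
  exact (Joint.mean_fst _).symm

lemma mean_grad2_F (p : Joint dx dy) : mean (fun i => grad2 (B.F i) p) = grad2 B.f p := by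
  simp only [grad2, hB.gradient_f]
  exact (Joint.mean_snd _).symm

lemma mean_grad2_G (p : Joint dx dy) : mean (fun j => grad2 (B.G j) p) = grad2 B.g p := by
  simp only [grad2, hB.gradient_g]
  exact (Joint.mean_snd _).symm

lemma mean_hess12_G (p : Joint dx dy) (z : Vec dy) :
    mean (fun j => hess12 (B.G j) p z) = hess12 B.g p z := by
  simp only [hess12, hB.hess_g]
  exact (Joint.mean_fst _).symm

lemma mean_hess22_G (p : Joint dx dy) (z : Vec dy) :
    mean (fun j => hess22 (B.G j) p z) = hess22 B.g p z := by
  simp only [hess22, hB.hess_g]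
  exact (Joint.mean_snd _).symm

end Regular
end FiniteSumBilevel

namespace FiniteSumBilevel
variable {B : FiniteSumBilevel dx dy n m}
namespace Regular

variable {K : ℝ} (hB : B.Regular K)
include hB

lemma differentiable_g : Differentiable ℝ B.g := hB.contDiff_g.differentiable (by norm_num)

lemma hasGradientAt_g (x : Vec dx) (y : Vec dy) :
    HasGradientAt (fun y => B.g (joint x y)) (grad2 B.g (joint x y)) y :=
  hasGradientAt_joint hB.differentiable_g x y

lemma yStar_le (x : Vec dx) (y : Vec dy) : B.g (joint x (B.yStar x)) ≤ B.g (joint x y) := by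
  have h : ∃ y, ∀ y', B.g (joint x y) ≤ B.g (joint x y') :=
    (hB.strong x).exists_forall_le (inv_pos.2 hB.pos) fun y =>
      (hB.hasGradientAt_g x y).differentiableAt
  exact Classical.epsilon_spec h y

lemma grad2_g_yStar (x : Vec dx) : grad2 B.g (joint x (B.yStar x)) = 0 := by
  have h : IsLocalMin (fun y => B.g (joint x y)) (B.yStar x) :=
    Filter.Eventually.of_forall fun y => hB.yStar_le x y
  have := h.hasFDerivAt_eq_zero (hB.hasGradientAt_g x _).hasFDerivAt
  simpa using this

lemma monotone_grad2_g (x : Vec dx) (y y' : Vec dy) :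
    K⁻¹ * ‖y - y'‖ ^ 2 ≤ inner ℝ (grad2 B.g (joint x y) - grad2 B.g (joint x y')) (y - y') :=
  (hB.strong x).monotone_gradient (hB.hasGradientAt_g x y) (hB.hasGradientAt_g x y')

lemma norm_grad2_g_sub_le (p q : Joint dx dy) : ‖grad2 B.g p - grad2 B.g q‖ ≤ K * ‖p - q‖ :=
  (Joint.norm_grad2_sub_le p q).trans (hB.lip_g p q)

/-- A lower bound on a bilinear pairing turned into a norm bound. -/
lemma norm_le_of_inner {E : Type*} [NormedAddCommGroup E] [InnerProductSpace ℝ E] {a b : E}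
    (h : K⁻¹ * ‖b‖ ^ 2 ≤ inner ℝ a b) : ‖b‖ ≤ K * ‖a‖ := by
  have hK := hB.pos
  have h1 := h.trans (real_inner_le_norm a b)
  rcases (norm_nonneg b).eq_or_lt with h0 | h0
  · rw [← h0]; positivity
  · rw [inv_mul_le_iff₀ hK] at h1
    nlinarith

/-- ∇₂g vanishes at both minimizers. Strong monotonicity at x therefore bounds their distance by the
change of ∇₂g when only the first argument moves. -/
lemma norm_yStar_sub_le (x x' : Vec dx) : ‖B.yStar x - B.yStar x'‖ ≤ K ^ 2 * ‖x - x'‖ := by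
  have h := hB.norm_le_of_inner (hB.monotone_grad2_g x (B.yStar x) (B.yStar x'))
  rw [hB.grad2_g_yStar x, ← hB.grad2_g_yStar x'] at h
  have h2 := hB.norm_grad2_g_sub_le (joint x' (B.yStar x')) (joint x (B.yStar x'))
  rw [joint_sub, sub_self, norm_joint_zero_right, norm_sub_rev] at h2
  have hK := hB.pos
  rw [norm_sub_rev x x']
  calc _ ≤ _ := h
    _ ≤ K * (K * ‖x' - x‖) := by rw [norm_sub_rev]; gcongr
    _ = _ := by ring

lemma norm_joint_yStar_sub_le (x x' : Vec dx) :
    ‖joint x (B.yStar x) - joint x' (B.yStar x')‖ ≤ 2 * K ^ 2 * ‖x - x'‖ := by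
  rw [joint_sub]
  have h1 := norm_joint_le (x - x') (B.yStar x - B.yStar x')
  have h2 := hB.norm_yStar_sub_le x x'
  have : ‖x - x'‖ ≤ K ^ 2 * ‖x - x'‖ :=
    le_mul_of_one_le_left (norm_nonneg _) (one_le_pow₀ hB.one_le)
  linarith

/-- Strong monotonicity of ∇₂g along y + t z, divided by t² in the limit t → 0+. -/
lemma hess22_coercive (p : Joint dx dy) (z : Vec dy) :
    K⁻¹ * ‖z‖ ^ 2 ≤ inner ℝ (hess22 B.g p z) z := by
  obtain ⟨x, y, rfl⟩ : ∃ x y, p = joint x y := ⟨p.fst, p.snd, rfl⟩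
  have hd : HasFDerivAt (fun y => grad2 B.g (joint x y))
      (((WithLp.sndL 2 ℝ (Vec dx) (Vec dy)).comp (hess B.g (joint x y))).comp
        (jointInr dx dy)) y := by
    have h1 := (hasFDerivAt_gradient_of_contDiff hB.contDiff_g (joint x y)).comp y
      (hasFDerivAt_joint x y)
    exact (WithLp.sndL 2 ℝ (Vec dx) (Vec dy)).hasFDerivAt.comp y h1
  have h1 : HasDerivAt (fun t : ℝ => y + t • z) z 0 := by
    simpa using ((hasDerivAt_id (0 : ℝ)).smul_const z).const_add y
  have h2 := HasFDerivAt.comp_hasDerivAt (0 : ℝ) (f := fun t : ℝ => y + t • z)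
    (by simpa using hd) h1
  have h3 := Filter.Tendsto.inner (𝕜 := ℝ) h2.tendsto_slope_zero_right
    (tendsto_const_nhds (x := z))
  refine ge_of_tendsto h3 ?_
  filter_upwards [self_mem_nhdsWithin] with t (ht : 0 < t)
  have := hB.monotone_grad2_g x (y + t • z) y
  rw [add_sub_cancel_left, norm_smul, Real.norm_of_nonneg ht.le, inner_smul_right, mul_pow] at this
  rw [inner_smul_left]
  simp only [Function.comp_def, zero_add, zero_smul, add_zero, conj_trivial]
  rw [le_inv_mul_iff₀ ht]
  nlinarith

/-- Coercivity makes the block injective, hence surjective in finite dimension, so the choice in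
`zStar` is a genuine solution. -/
lemma hess22_zStar (x : Vec dx) : hess22 B.g (joint x (B.yStar x)) (B.zStar x)
    = grad2 B.f (joint x (B.yStar x)) := by
  set p := joint x (B.yStar x) with hp
  let A : Vec dy →ₗ[ℝ] Vec dy :=
    ((WithLp.sndL 2 ℝ (Vec dx) (Vec dy)).comp ((hess B.g p).comp (jointInr dx dy))).toLinearMap
  have hA : ∀ z, A z = hess22 B.g p z := fun z => rfl
  have hinj : Function.Injective A := by
    rw [← LinearMap.ker_eq_bot, LinearMap.ker_eq_bot']
    intro z hz
    have := hB.norm_le_of_inner (hB.hess22_coercive p z)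
    rw [← hA, hz, norm_zero, mul_zero] at this
    exact norm_le_zero_iff.1 this
  obtain ⟨z, hz⟩ := (LinearMap.injective_iff_surjective.1 hinj) (grad2 B.f p)
  exact Classical.epsilon_spec (p := fun z => hess22 B.g p z = grad2 B.f p) ⟨z, hz⟩

/-- The a priori bound on ∇₂f along the lower-level solutions enters here. It makes p ↦ ∇²g(p) z*(x)
Lipschitz with a uniform constant, although the iterates z are unrestricted. -/
lemma norm_zStar_le (x : Vec dx) : ‖B.zStar x‖ ≤ K ^ 2 := by
  have h := hB.norm_le_of_inner (hB.hess22_coercive (joint x (B.yStar x)) (B.zStar x))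
  rw [hB.hess22_zStar] at h
  have := mul_le_mul_of_nonneg_left (hB.bound x) hB.pos.le
  nlinarith

lemma norm_hess12_g_sub_le (p q : Joint dx dy) (x : Vec dx) :
    ‖hess12 B.g p (B.zStar x) - hess12 B.g q (B.zStar x)‖ ≤ K ^ 3 * ‖p - q‖ := by
  have hK := hB.pos
  calc _ ≤ _ := norm_hess12_sub_le _ p q _
    _ ≤ (K * ‖p - q‖) * K ^ 2 := by gcongr; exacts [hB.lip_hess_g p q, hB.norm_zStar_le x]
    _ = _ := by ring

lemma norm_hess22_g_sub_le (p q : Joint dx dy) (x : Vec dx) :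
    ‖hess22 B.g p (B.zStar x) - hess22 B.g q (B.zStar x)‖ ≤ K ^ 3 * ‖p - q‖ := by
  have hK := hB.pos
  calc _ ≤ _ := norm_hess22_sub_le _ p q _
    _ ≤ (K * ‖p - q‖) * K ^ 2 := by gcongr; exacts [hB.lip_hess_g p q, hB.norm_zStar_le x]
    _ = _ := by ring

lemma norm_hess12_g_le (p : Joint dx dy) (z : Vec dy) : ‖hess12 B.g p z‖ ≤ K * ‖z‖ :=
  (norm_hess12_le _ p z).trans (by gcongr; exact hB.norm_hess_g p)

lemma norm_hess22_g_le (p : Joint dx dy) (z : Vec dy) : ‖hess22 B.g p z‖ ≤ K * ‖z‖ :=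
  (norm_hess22_le _ p z).trans (by gcongr; exact hB.norm_hess_g p)

lemma norm_grad1_f_sub_le (p q : Joint dx dy) : ‖grad1 B.f p - grad1 B.f q‖ ≤ K * ‖p - q‖ :=
  (Joint.norm_grad1_sub_le p q).trans (hB.lip_f p q)

lemma norm_grad2_f_sub_le (p q : Joint dx dy) : ‖grad2 B.f p - grad2 B.f q‖ ≤ K * ‖p - q‖ :=
  (Joint.norm_grad2_sub_le p q).trans (hB.lip_f p q)

lemma K_le_pow (k : ℕ) (hk : k ≠ 0) : K ≤ K ^ k := le_self_pow₀ hB.one_le hk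

lemma pow_le_pow {k l : ℕ} (h : k ≤ l) : K ^ k ≤ K ^ l := pow_le_pow_right₀ hB.one_le h

/-- The residual of `z*(x)` in the linear system at another lower-level point. -/
lemma norm_residual_le (p : Joint dx dy) (x : Vec dx) :
    ‖hess22 B.g p (B.zStar x) - grad2 B.f p‖ ≤ 2 * K ^ 3 * ‖p - joint x (B.yStar x)‖ := by
  have h1 := hB.norm_hess22_g_sub_le p (joint x (B.yStar x)) x
  have h2 := hB.norm_grad2_f_sub_le p (joint x (B.yStar x))
  have h3 : hess22 B.g p (B.zStar x) - grad2 B.f p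
      = (hess22 B.g p (B.zStar x) - hess22 B.g (joint x (B.yStar x)) (B.zStar x))
        - (grad2 B.f p - grad2 B.f (joint x (B.yStar x))) := by
    rw [hB.hess22_zStar]; abel
  rw [h3]
  have h4 := norm_sub_le
    (hess22 B.g p (B.zStar x) - hess22 B.g (joint x (B.yStar x)) (B.zStar x))
    (grad2 B.f p - grad2 B.f (joint x (B.yStar x)))
  have h5 := mul_le_mul_of_nonneg_right (hB.K_le_pow 3 (by norm_num))
    (norm_nonneg (p - joint x (B.yStar x)))
  linarith

/-- z*(x') almost solves the system at x: its residual there is of the order of the distance between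
the two lower-level solutions, and coercivity turns the residual into a distance. -/
lemma norm_zStar_sub_le (x x' : Vec dx) : ‖B.zStar x - B.zStar x'‖ ≤ 4 * K ^ 6 * ‖x - x'‖ := by
  have hK := hB.pos
  set p := joint x (B.yStar x) with hp
  have h := hB.norm_le_of_inner (hB.hess22_coercive p (B.zStar x' - B.zStar x))
  rw [hess22_sub, hB.hess22_zStar x] at h
  have h1 := hB.norm_residual_le p x'
  have h2 := hB.norm_joint_yStar_sub_le x x'
  rw [norm_sub_rev]
  calc _ ≤ _ := h
    _ ≤ K * (2 * K ^ 3 * (2 * K ^ 2 * ‖x - x'‖)) := by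
        gcongr
        exact h1.trans (by gcongr)
    _ = _ := by ring

lemma norm_hyperGrad_sub_le (x x' : Vec dx) :
    ‖B.hyperGrad x - B.hyperGrad x'‖ ≤ 8 * K ^ 7 * ‖x - x'‖ := by
  have hK := hB.pos
  set p := joint x (B.yStar x) with hp
  set q := joint x' (B.yStar x') with hq
  have h0 := hB.norm_joint_yStar_sub_le x x'
  have h1 := hB.norm_grad1_f_sub_le p q
  have h2 := hB.norm_hess12_g_sub_le p q x
  have h3 := hB.norm_hess12_g_le q (B.zStar x - B.zStar x')
  have h4 := hB.norm_zStar_sub_le x x'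
  have e : B.hyperGrad x - B.hyperGrad x' = (grad1 B.f p - grad1 B.f q)
      - ((hess12 B.g p (B.zStar x) - hess12 B.g q (B.zStar x))
        + hess12 B.g q (B.zStar x - B.zStar x')) := by
    rw [hess12_sub, hyperGrad, hyperGrad]; abel
  have h5 := norm_sub_le (grad1 B.f p - grad1 B.f q)
    ((hess12 B.g p (B.zStar x) - hess12 B.g q (B.zStar x))
        + hess12 B.g q (B.zStar x - B.zStar x'))
  have h6 := norm_add_le (hess12 B.g p (B.zStar x) - hess12 B.g q (B.zStar x))
        (hess12 B.g q (B.zStar x - B.zStar x'))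
  rw [e]
  calc _ ≤ K * (2 * K ^ 2 * ‖x - x'‖) + (K ^ 3 * (2 * K ^ 2 * ‖x - x'‖)
        + K * (4 * K ^ 6 * ‖x - x'‖)) := by
        refine h5.trans (add_le_add (h1.trans (by gcongr)) (h6.trans (add_le_add
          (h2.trans (by gcongr)) (h3.trans (by gcongr)))))
    _ = (2 * K ^ 3 + 2 * K ^ 5 + 4 * K ^ 7) * ‖x - x'‖ := by ring
    _ ≤ 8 * K ^ 7 * ‖x - x'‖ := by
        gcongr
        linarith [hB.pow_le_pow (show 3 ≤ 7 by norm_num), hB.pow_le_pow (show 5 ≤ 7 by norm_num)]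

/-- First-order expansion of `H` with quadratic error. -/
lemma abs_H_sub_le (x x' : Vec dx) :
    |B.H x' - B.H x - inner ℝ (B.hyperGrad x) (x' - x)| ≤ 8 * K ^ 7 * ‖x' - x‖ ^ 2 := by
  have hK := hB.pos
  set p := joint x (B.yStar x) with hp
  set q := joint x' (B.yStar x') with hq
  have h0 : ‖q - p‖ ≤ 2 * K ^ 2 * ‖x' - x‖ := hB.norm_joint_yStar_sub_le x' x
  have hf : |B.f q - B.f p - inner ℝ (gradient B.f p) (q - p)| ≤ K * ‖q - p‖ ^ 2 := by
    have := norm_taylor_le (ψ := B.f) (ψ' := fun p => InnerProductSpace.toDual ℝ _ (gradient B.f p))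
      (fun p => by
        have := (hB.hasGradientAt_f p).hasFDerivAt
        rwa [← hB.gradient_f p] at this) (K := K)
      (fun p q => by rw [← map_sub, LinearIsometryEquiv.norm_map]; exact hB.lip_f p q) hK.le p q
    simpa using this
  have hg : ‖gradient B.g q - gradient B.g p - hess B.g p (q - p)‖ ≤ K * ‖q - p‖ ^ 2 :=
    norm_taylor_le (hasFDerivAt_gradient_of_contDiff hB.contDiff_g) hB.lip_hess_g hK.le p q
  -- The adjoint identity. Since ∇₂f = ∇²₂₂g z*, symmetry of the Hessian moves z* onto ∇²g(p)(q -
  -- p). The y-components of ∇g vanish at p and at q, so their difference can be subtracted at no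
  -- cost, and what remains is a Taylor remainder of ∇g. The derivative of y* is never needed.
  have hin : inner ℝ (gradient B.f p) (q - p) - inner ℝ (B.hyperGrad x) (x' - x)
      = inner ℝ (B.zStar x) (hess B.g p (q - p) - (gradient B.g q - gradient B.g p)).snd := by
    have e1 : (gradient B.g q).snd = 0 := hB.grad2_g_yStar x'
    have e2 : (gradient B.g p).snd = 0 := hB.grad2_g_yStar x
    have e3 : (hess B.g p (q - p) - (gradient B.g q - gradient B.g p)).snd
        = (hess B.g p (q - p)).snd := by
      simp [e1, e2]
    have e4 : inner ℝ (gradient B.f p) (q - p) = inner ℝ (grad1 B.f p) (x' - x)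
        + inner ℝ (hess22 B.g p (B.zStar x)) (B.yStar x' - B.yStar x) := by
      rw [Joint.inner_eq, hB.hess22_zStar]; rfl
    have e5 : inner ℝ (hess B.g p (joint 0 (B.zStar x))) (q - p)
        = inner ℝ (hess12 B.g p (B.zStar x)) (x' - x)
        + inner ℝ (hess22 B.g p (B.zStar x)) (B.yStar x' - B.yStar x) := by
      rw [Joint.inner_eq]; rfl
    rw [hess_symm_of_contDiff hB.contDiff_g, real_inner_comm, Joint.inner_joint_zero,
      real_inner_comm] at e5
    rw [e3, e4, e5, hyperGrad, inner_sub_left]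
    ring
  have hz : |inner ℝ (B.zStar x) (hess B.g p (q - p) - (gradient B.g q - gradient B.g p)).snd|
      ≤ K ^ 2 * (K * ‖q - p‖ ^ 2) := by
    refine (abs_real_inner_le_norm _ _).trans ?_
    gcongr
    · exact hB.norm_zStar_le x
    · refine (Joint.norm_snd_le _).trans ?_
      rwa [norm_sub_rev]
  have e : B.H x' - B.H x - inner ℝ (B.hyperGrad x) (x' - x)
      = (B.f q - B.f p - inner ℝ (gradient B.f p) (q - p))
        + inner ℝ (B.zStar x) (hess B.g p (q - p) - (gradient B.g q - gradient B.g p)).snd := by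
    rw [← hin, H, H]; ring
  rw [e]
  calc _ ≤ K * ‖q - p‖ ^ 2 + K ^ 2 * (K * ‖q - p‖ ^ 2) := (abs_add_le _ _).trans (add_le_add hf hz)
    _ = (K + K ^ 3) * ‖q - p‖ ^ 2 := by ring
    _ ≤ (K ^ 3 + K ^ 3) * (2 * K ^ 2 * ‖x' - x‖) ^ 2 := by
        gcongr; exact hB.K_le_pow 3 (by norm_num)
    _ = _ := by ring

lemma hasGradientAt_H (x : Vec dx) : HasGradientAt B.H (B.hyperGrad x) x := by
  rw [hasGradientAt_iff_isLittleO]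
  refine Asymptotics.IsBigO.trans_isLittleO (g := fun x' => ‖x' - x‖ ^ 2)
    (Asymptotics.IsBigO.of_bound (8 * K ^ 7) (Filter.Eventually.of_forall fun x' => ?_)) ?_
  · rw [Real.norm_eq_abs, Real.norm_of_nonneg (by positivity)]
    exact hB.abs_H_sub_le x x'
  · have h1 : Filter.Tendsto (fun x' => ‖x' - x‖) (nhds x) (nhds 0) := by
      have : Continuous fun x' => ‖x' - x‖ := by fun_prop
      simpa using this.tendsto x
    have h2 : (fun x' => ‖x' - x‖ ^ 2) = fun x' => ‖x' - x‖ * ‖x' - x‖ := by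
      funext x'; ring
    rw [h2]
    have h3 : (fun x' => ‖x' - x‖) =o[nhds x] fun _ => (1 : ℝ) :=
      (Asymptotics.isLittleO_one_iff ℝ).2 h1
    have h4 := h3.mul_isBigO (Asymptotics.isBigO_refl (fun x' => ‖x' - x‖) (nhds x))
    simp only [one_mul] at h4
    exact h4.norm_right.trans_isBigO (by simpa using Asymptotics.isBigO_refl _ _)

lemma gradient_H (x : Vec dx) : gradient B.H x = B.hyperGrad x := (hB.hasGradientAt_H x).gradient

lemma differentiable_H : Differentiable ℝ B.H := fun x => (hB.hasGradientAt_H x).differentiableAt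

end Regular
end FiniteSumBilevel

/-! ### Error quantities and bounds for directions and component oracles -/

/-- The squared distance of two triples. -/
def Triple.sqDist (u w : Triple dx dy) : ℝ :=
  ‖u.x - w.x‖ ^ 2 + ‖u.y - w.y‖ ^ 2 + ‖u.z - w.z‖ ^ 2

lemma Triple.sqDist_nonneg (u w : Triple dx dy) : 0 ≤ u.sqDist w := by
  unfold Triple.sqDist; positivity

lemma Triple.norm_joint_sub_sq_le (u w : Triple dx dy) :
    ‖joint u.x u.y - joint w.x w.y‖ ^ 2 ≤ u.sqDist w := by
  rw [joint_sub, norm_joint_sq, Triple.sqDist]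
  linarith [sq_nonneg ‖u.z - w.z‖]

/-- The mean squared distance of a point to the entries of a memory table. -/
def tableErr {ι : Type*} [Fintype ι] (u : Triple dx dy) (w : ι → Triple dx dy) : ℝ :=
  mean fun i => u.sqDist (w i)

lemma tableErr_nonneg {ι : Type*} [Fintype ι] (u : Triple dx dy) (w : ι → Triple dx dy) :
    0 ≤ tableErr u w := mean_nonneg fun _ => Triple.sqDist_nonneg _ _

/-- The total memory error. -/
def Memory.err (w : Memory dx dy n m) (u : Triple dx dy) : ℝ := tableErr u w.f + tableErr u w.g

lemma Memory.err_nonneg (w : Memory dx dy n m) (u : Triple dx dy) : 0 ≤ w.err u :=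
  add_nonneg (tableErr_nonneg _ _) (tableErr_nonneg _ _)

namespace FiniteSumBilevel

/-- The squared error of the lower-level variable. -/
def yErr (B : FiniteSumBilevel dx dy n m) (u : Triple dx dy) : ℝ := ‖u.y - B.yStar u.x‖ ^ 2

/-- The squared error of the linear system variable. -/
def zErr (B : FiniteSumBilevel dx dy n m) (u : Triple dx dy) : ℝ := ‖u.z - B.zStar u.x‖ ^ 2

lemma yErr_nonneg (B : FiniteSumBilevel dx dy n m) (u : Triple dx dy) : 0 ≤ B.yErr u :=
  sq_nonneg _

lemma zErr_nonneg (B : FiniteSumBilevel dx dy n m) (u : Triple dx dy) : 0 ≤ B.zErr u :=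
  sq_nonneg _

/-- `∇₁ f - ∇²₁₂ g z`. -/
def dirX (B : FiniteSumBilevel dx dy n m) (u : Triple dx dy) : Vec dx :=
  grad1 B.f (joint u.x u.y) - hess12 B.g (joint u.x u.y) u.z

/-- `∇₂ g`. -/
def dirY (B : FiniteSumBilevel dx dy n m) (u : Triple dx dy) : Vec dy :=
  grad2 B.g (joint u.x u.y)

/-- `∇²₂₂ g z - ∇₂ f`. -/
def dirZ (B : FiniteSumBilevel dx dy n m) (u : Triple dx dy) : Vec dy :=
  hess22 B.g (joint u.x u.y) u.z - grad2 B.f (joint u.x u.y)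

/-- A common Lipschitz constant for all the maps of a regular problem. -/
def lipConst (K : ℝ) : ℝ := 256 * K ^ 14

lemma norm_joint_sub_yStar (B : FiniteSumBilevel dx dy n m) (u : Triple dx dy) :
    ‖joint u.x u.y - joint u.x (B.yStar u.x)‖ = ‖u.y - B.yStar u.x‖ := by
  rw [joint_sub, sub_self, norm_joint_zero_left]

lemma dirZ_eq (B : FiniteSumBilevel dx dy n m) (u : Triple dx dy) :
    B.dirZ u = hess22 B.g (joint u.x u.y) (u.z - B.zStar u.x)
    + (hess22 B.g (joint u.x u.y) (B.zStar u.x) - grad2 B.f (joint u.x u.y)) := by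
  rw [hess22_sub, dirZ]; abel

variable {B : FiniteSumBilevel dx dy n m}
namespace Regular

variable {K : ℝ} (hB : B.Regular K)
include hB

lemma one_le_lipConst : 1 ≤ lipConst K := by
  unfold lipConst
  linarith [one_le_pow₀ (n := 14) hB.one_le]

lemma mul_pow_le_lipConst {c : ℝ} (hc : c ≤ 256) {k : ℕ} (hk : k ≤ 14) :
    c * K ^ k ≤ lipConst K := by
  have hK := hB.pos
  exact mul_le_mul hc (hB.pow_le_pow hk) (by positivity) (by norm_num)

/-- `lipConst K` is the square of 16 K⁷, which dominates every unsquared constant c K^k with c ≤ 16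
and k ≤ 7. -/
lemma sq_le_lipConst {a b c : ℝ} {k : ℕ} (ha : 0 ≤ a) (hc : c ≤ 16) (hc0 : 0 ≤ c) (hk : k ≤ 7)
    (h : a ≤ c * K ^ k * b) : a ^ 2 ≤ lipConst K * b ^ 2 := by
  have hK := hB.pos
  calc a ^ 2 ≤ (c * K ^ k * b) ^ 2 := by gcongr
    _ = c ^ 2 * K ^ (2 * k) * b ^ 2 := by ring
    _ ≤ lipConst K * b ^ 2 := by
        refine mul_le_mul_of_nonneg_right (hB.mul_pow_le_lipConst ?_ ?_) (sq_nonneg b)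
        · nlinarith
        · omega

lemma yStar_sub_sq_le (x x' : Vec dx) :
    ‖B.yStar x - B.yStar x'‖ ^ 2 ≤ lipConst K * ‖x - x'‖ ^ 2 :=
  hB.sq_le_lipConst (c := 1) (k := 2) (norm_nonneg _) (by norm_num) (by norm_num) (by norm_num)
    (by simpa using hB.norm_yStar_sub_le x x')

lemma zStar_sub_sq_le (x x' : Vec dx) :
    ‖B.zStar x - B.zStar x'‖ ^ 2 ≤ lipConst K * ‖x - x'‖ ^ 2 :=
  hB.sq_le_lipConst (norm_nonneg _) (by norm_num) (by norm_num) (by norm_num)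
    (hB.norm_zStar_sub_le x x')

lemma hyperGrad_sub_sq_le (x x' : Vec dx) :
    ‖B.hyperGrad x - B.hyperGrad x'‖ ^ 2 ≤ lipConst K * ‖x - x'‖ ^ 2 :=
  hB.sq_le_lipConst (norm_nonneg _) (by norm_num) (by norm_num) (by norm_num)
    (hB.norm_hyperGrad_sub_le x x')

lemma H_le (x x' : Vec dx) :
    B.H x' ≤ B.H x + inner ℝ (B.hyperGrad x) (x' - x) + lipConst K * ‖x' - x‖ ^ 2 := by
  have h := (abs_le.1 (hB.abs_H_sub_le x x')).2
  have h2 := mul_le_mul_of_nonneg_right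
    (hB.mul_pow_le_lipConst (c := 8) (k := 7) (by norm_num) (by norm_num))
    (sq_nonneg ‖x' - x‖)
  linarith

/-- Splitting z = z* + (z - z*) avoids any bound on z: the change of the Hessian acts on the bounded
vector z*, and only the operator bound is used on z - z*. -/
lemma dirX_sub_sq_le (u : Triple dx dy) :
    ‖B.dirX u - B.hyperGrad u.x‖ ^ 2 ≤ lipConst K * (B.yErr u + B.zErr u) := by
  have hK := hB.pos
  set p := joint u.x u.y with hp
  set q := joint u.x (B.yStar u.x) with hq
  have h0 : ‖p - q‖ = ‖u.y - B.yStar u.x‖ := B.norm_joint_sub_yStar u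
  have e : B.dirX u - B.hyperGrad u.x = ((grad1 B.f p - grad1 B.f q)
      - (hess12 B.g p (B.zStar u.x) - hess12 B.g q (B.zStar u.x)))
      - hess12 B.g p (u.z - B.zStar u.x) := by
    rw [hess12_sub, dirX, hyperGrad]; abel
  have h1 := hB.norm_grad1_f_sub_le p q
  have h2 := hB.norm_hess12_g_sub_le p q u.x
  have h3 := hB.norm_hess12_g_le p (u.z - B.zStar u.x)
  have h4 := norm_sub_le (grad1 B.f p - grad1 B.f q)
    (hess12 B.g p (B.zStar u.x) - hess12 B.g q (B.zStar u.x))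
  have h5 : K * ‖p - q‖ ≤ K ^ 3 * ‖p - q‖ := by gcongr; exact hB.K_le_pow 3 (by norm_num)
  have h6 := norm_sub_sq_le_two ((grad1 B.f p - grad1 B.f q)
      - (hess12 B.g p (B.zStar u.x) - hess12 B.g q (B.zStar u.x)))
      (hess12 B.g p (u.z - B.zStar u.x))
  have h7 := pow_le_pow_left₀ (norm_nonneg _) h3 2
  have h8 := pow_le_pow_left₀ (norm_nonneg _)
    (h4.trans (show _ ≤ 2 * K ^ 3 * ‖p - q‖ by linarith)) 2
  rw [e]
  calc _ ≤ 2 * (2 * K ^ 3 * ‖p - q‖) ^ 2 + 2 * (K * ‖u.z - B.zStar u.x‖) ^ 2 := by linarith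
    _ = (8 * K ^ 6) * B.yErr u + (2 * K ^ 2) * B.zErr u := by rw [h0, yErr, zErr]; ring
    _ ≤ lipConst K * B.yErr u + lipConst K * B.zErr u := by
        refine add_le_add (mul_le_mul_of_nonneg_right ?_ (B.yErr_nonneg u))
          (mul_le_mul_of_nonneg_right ?_ (B.zErr_nonneg u)) <;>
        exact hB.mul_pow_le_lipConst (by norm_num) (by norm_num)
    _ = _ := by ring

lemma dirY_inner (u : Triple dx dy) :
    K⁻¹ * B.yErr u ≤ inner ℝ (B.dirY u) (u.y - B.yStar u.x) := by
  simpa [hB.grad2_g_yStar, yErr, dirY] using hB.monotone_grad2_g u.x u.y (B.yStar u.x)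

lemma dirY_sq_le (u : Triple dx dy) : ‖B.dirY u‖ ^ 2 ≤ lipConst K * B.yErr u := by
  refine hB.sq_le_lipConst (c := 1) (k := 1) (norm_nonneg _) (by norm_num) (by norm_num)
    (by norm_num) ?_
  rw [← B.norm_joint_sub_yStar]
  simpa [hB.grad2_g_yStar, dirY] using
    hB.norm_grad2_g_sub_le (joint u.x u.y) (joint u.x (B.yStar u.x))

lemma residual_sq_le (u : Triple dx dy) :
    ‖hess22 B.g (joint u.x u.y) (B.zStar u.x) - grad2 B.f (joint u.x u.y)‖ ^ 2
      ≤ 4 * K ^ 6 * B.yErr u := by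
  have h := hB.norm_residual_le (joint u.x u.y) u.x
  rw [B.norm_joint_sub_yStar] at h
  calc _ ≤ _ := pow_le_pow_left₀ (norm_nonneg _) h 2
    _ = _ := by rw [yErr]; ring

/-- Coercivity controls z - z*, but z* solves the system at y* and not at y. The resulting residual
is of the order of the error of y; Young with weight K spends half of the coercivity on it. -/
lemma dirZ_inner (u : Triple dx dy) :
    K⁻¹ * B.zErr u - lipConst K * B.yErr u
      ≤ 2 * inner ℝ (B.dirZ u) (u.z - B.zStar u.x) := by
  have hK := hB.pos
  have h1 := hB.hess22_coercive (joint u.x u.y) (u.z - B.zStar u.x)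
  have h2 := two_inner_le K hK
    (-(hess22 B.g (joint u.x u.y) (B.zStar u.x) - grad2 B.f (joint u.x u.y))) (u.z - B.zStar u.x)
  rw [norm_neg, inner_neg_left] at h2
  have h3 := mul_le_mul_of_nonneg_left (hB.residual_sq_le u) hK.le
  have h4 := mul_le_mul_of_nonneg_right (hB.mul_pow_le_lipConst (c := 4) (k := 7) (by norm_num)
    (by norm_num)) (B.yErr_nonneg u)
  rw [B.dirZ_eq, inner_add_left]
  have h5 : K * (4 * K ^ 6 * B.yErr u) = 4 * K ^ 7 * B.yErr u := by ring
  change K⁻¹ * B.zErr u ≤ _ at h1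
  change _ ≤ _ + K⁻¹ * B.zErr u at h2
  linarith

lemma dirZ_sq_le (u : Triple dx dy) : ‖B.dirZ u‖ ^ 2 ≤ lipConst K * (B.yErr u + B.zErr u) := by
  have h1 := hB.norm_hess22_g_le (joint u.x u.y) (u.z - B.zStar u.x)
  have h2 := pow_le_pow_left₀ (norm_nonneg _) h1 2
  have h3 := hB.residual_sq_le u
  rw [B.dirZ_eq]
  have h4 := norm_add_sq_le_two (hess22 B.g (joint u.x u.y) (u.z - B.zStar u.x))
    (hess22 B.g (joint u.x u.y) (B.zStar u.x) - grad2 B.f (joint u.x u.y))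
  calc _ ≤ 2 * (K * ‖u.z - B.zStar u.x‖) ^ 2 + 2 * (4 * K ^ 6 * B.yErr u) := by linarith
    _ = (8 * K ^ 6) * B.yErr u + (2 * K ^ 2) * B.zErr u := by rw [zErr]; ring
    _ ≤ lipConst K * B.yErr u + lipConst K * B.zErr u := by
        refine add_le_add (mul_le_mul_of_nonneg_right ?_ (B.yErr_nonneg u))
          (mul_le_mul_of_nonneg_right ?_ (B.zErr_nonneg u)) <;>
        exact hB.mul_pow_le_lipConst (by norm_num) (by norm_num)
    _ = _ := by ring

/-- The bound shared by all the component oracles. -/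
lemma le_of_gradient_lip (u w : Triple dx dy) {a : ℝ} (ha : 0 ≤ a)
    (h : a ≤ K * ‖joint u.x u.y - joint w.x w.y‖) :
    a ^ 2 ≤ lipConst K / 4 * (u.sqDist w + B.zErr u) := by
  calc a ^ 2 ≤ (K * ‖joint u.x u.y - joint w.x w.y‖) ^ 2 := by gcongr
    _ = K ^ 2 * ‖joint u.x u.y - joint w.x w.y‖ ^ 2 := by ring
    _ ≤ lipConst K / 4 * (u.sqDist w + B.zErr u) := by
        refine mul_le_mul ?_ ?_ (by positivity) (by linarith [hB.one_le_lipConst])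
        · linarith [hB.mul_pow_le_lipConst (c := 4) (k := 2) (by norm_num) (by norm_num)]
        · linarith [u.norm_joint_sub_sq_le w, B.zErr_nonneg u]

lemma grad1_F_sub_sq_le (i : Fin n) (u w : Triple dx dy) :
    ‖grad1 (B.F i) (joint u.x u.y) - grad1 (B.F i) (joint w.x w.y)‖ ^ 2
      ≤ lipConst K / 4 * (u.sqDist w + B.zErr u) :=
  hB.le_of_gradient_lip u w (norm_nonneg _) ((Joint.norm_grad1_sub_le _ _).trans (hB.lip_F i _ _))

lemma grad2_F_sub_sq_le (i : Fin n) (u w : Triple dx dy) :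
    ‖grad2 (B.F i) (joint u.x u.y) - grad2 (B.F i) (joint w.x w.y)‖ ^ 2
      ≤ lipConst K / 4 * (u.sqDist w + B.zErr u) :=
  hB.le_of_gradient_lip u w (norm_nonneg _) ((Joint.norm_grad2_sub_le _ _).trans (hB.lip_F i _ _))

lemma grad2_G_sub_sq_le (j : Fin m) (u w : Triple dx dy) :
    ‖grad2 (B.G j) (joint u.x u.y) - grad2 (B.G j) (joint w.x w.y)‖ ^ 2
      ≤ lipConst K / 4 * (u.sqDist w + B.zErr u) :=
  hB.le_of_gradient_lip u w (norm_nonneg _) ((Joint.norm_grad2_sub_le _ _).trans (hB.lip_G j _ _))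

/-- The product `T(p) z` of a Lipschitz bounded operator field and a vector, with `z` unbounded. -/
lemma hess_mul_sub_sq_le {V : Type*} [NormedAddCommGroup V] {T : Joint dx dy → Vec dy → V}
    {N : Joint dx dy → Joint dx dy → ℝ}
    (hsub : ∀ p z z', T p (z - z') = T p z - T p z') (hT : ∀ p z, ‖T p z‖ ≤ K * ‖z‖)
    (hTN : ∀ p q z, ‖T p z - T q z‖ ≤ N p q * ‖z‖) (hN : ∀ p q, N p q ≤ K * ‖p - q‖)
    (u w : Triple dx dy) :
    ‖T (joint u.x u.y) u.z - T (joint w.x w.y) w.z‖ ^ 2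
      ≤ lipConst K / 4 * (u.sqDist w + B.zErr u) := by
  have hK := hB.pos
  set p := joint u.x u.y
  set q := joint w.x w.y
  set z := B.zStar u.x
  -- Three pieces: on the bounded vector z* the field is Lipschitz; on u.z - z*, which may be large,
  -- only the operator bound is available, and this produces `zErr`; the last piece sees only u.z -
  -- w.z.
  have e : T p u.z - T q w.z
      = ((T p z - T q z) + (T p (u.z - z) - T q (u.z - z))) + T q (u.z - w.z) := by
    rw [hsub, hsub, hsub]; abel
  have h1 : ‖T p z - T q z‖ ≤ K ^ 3 * ‖p - q‖ :=
    calc _ ≤ _ := hTN p q z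
      _ ≤ (K * ‖p - q‖) * K ^ 2 := by
          gcongr
          exacts [hN p q, hB.norm_zStar_le u.x]
      _ = _ := by ring
  have h2 : ‖T p (u.z - z) - T q (u.z - z)‖ ≤ 2 * K * ‖u.z - z‖ := by
    linarith [norm_sub_le (T p (u.z - z)) (T q (u.z - z)), hT p (u.z - z), hT q (u.z - z)]
  have h3 := pow_le_pow_left₀ (norm_nonneg _) (hT q (u.z - w.z)) 2
  have h1' := pow_le_pow_left₀ (norm_nonneg _) h1 2
  have h2' := pow_le_pow_left₀ (norm_nonneg _) h2 2
  have h4 := norm_add_sq_le_two (T p z - T q z) (T p (u.z - z) - T q (u.z - z))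
  have h5 := norm_add_sq_le_two ((T p z - T q z) + (T p (u.z - z) - T q (u.z - z)))
    (T q (u.z - w.z))
  have hd' : ‖p - q‖ ^ 2 + ‖u.z - w.z‖ ^ 2 = u.sqDist w := by
    rw [Triple.sqDist, ← norm_joint_sq, ← joint_sub]
  have hc : ∀ {c : ℝ} {k : ℕ}, 4 * c ≤ 256 → k ≤ 14 → c * K ^ k ≤ lipConst K / 4 := by
    intro c k hc hk
    linarith [hB.mul_pow_le_lipConst (c := 4 * c) hc hk]
  rw [e]
  calc _ ≤ 4 * (K ^ 3 * ‖p - q‖) ^ 2 + 4 * (2 * K * ‖u.z - z‖) ^ 2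
        + 2 * (K * ‖u.z - w.z‖) ^ 2 := by linarith
    _ = (4 * K ^ 6) * ‖p - q‖ ^ 2 + (16 * K ^ 2) * B.zErr u + (2 * K ^ 2) * ‖u.z - w.z‖ ^ 2 := by
        rw [zErr]; ring
    _ ≤ lipConst K / 4 * ‖p - q‖ ^ 2 + lipConst K / 4 * B.zErr u
        + lipConst K / 4 * ‖u.z - w.z‖ ^ 2 := by
        have := B.zErr_nonneg u
        gcongr <;> exact hc (by norm_num) (by norm_num)
    _ = _ := by rw [← hd']; ring

lemma hess12_G_sub_sq_le (j : Fin m) (u w : Triple dx dy) :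
    ‖hess12 (B.G j) (joint u.x u.y) u.z - hess12 (B.G j) (joint w.x w.y) w.z‖ ^ 2
      ≤ lipConst K / 4 * (u.sqDist w + B.zErr u) :=
  hB.hess_mul_sub_sq_le (hess12_sub _)
    (fun p z => (norm_hess12_le _ p z).trans (by gcongr; exact hB.norm_hess_G j p))
    (fun p q z => norm_hess12_sub_le _ p q z) (hB.lip_hess_G j) u w

lemma hess22_G_sub_sq_le (j : Fin m) (u w : Triple dx dy) :
    ‖hess22 (B.G j) (joint u.x u.y) u.z - hess22 (B.G j) (joint w.x w.y) w.z‖ ^ 2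
      ≤ lipConst K / 4 * (u.sqDist w + B.zErr u) :=
  hB.hess_mul_sub_sq_le (hess22_sub _)
    (fun p z => (norm_hess22_le _ p z).trans (by gcongr; exact hB.norm_hess_G j p))
    (fun p q z => norm_hess22_sub_le _ p q z) (hB.lip_hess_G j) u w

end Regular
end FiniteSumBilevel

/-! ### SAGA estimators and memory tables -/

section Saga

variable {N : ℕ} {E : Type*} [NormedAddCommGroup E] [InnerProductSpace ℝ E]

lemma saga_eq (φ : Fin N → Triple dx dy → E) (w : Fin N → Triple dx dy) (u : Triple dx dy)
    (i : Fin N) :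
    saga φ w u i = (φ i u - φ i (w i)) + mean fun l => φ l (w l) := by
  simp [saga, mean]

lemma mean_saga [NeZero N] (φ : Fin N → Triple dx dy → E) (w : Fin N → Triple dx dy)
    (u : Triple dx dy) : mean (saga φ w u) = mean fun i => φ i u := by
  have : saga φ w u = fun i => (φ i u - φ i (w i)) + mean fun l => φ l (w l) :=
    funext (saga_eq φ w u)
  rw [this, mean_add, mean_const, mean_sub]
  abel

/-- The memory acts as a control variate: the deviation of the estimator is φ_i(u) - φ_i(w_i)
centred at its mean, so its variance is at most the second moment of these increments. -/
lemma var_saga_le [NeZero N] (φ : Fin N → Triple dx dy → E) (w : Fin N → Triple dx dy)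
    (u : Triple dx dy) {c Z : ℝ} (h : ∀ i, ‖φ i u - φ i (w i)‖ ^ 2 ≤ c * (u.sqDist (w i) + Z)) :
    mean (fun i => ‖saga φ w u i - mean fun i => φ i u‖ ^ 2) ≤ c * (tableErr u w + Z) := by
  have e : ∀ i, saga φ w u i - (mean fun i => φ i u)
      = (φ i u - φ i (w i)) - mean fun i => (φ i u - φ i (w i)) := by
    intro i
    rw [saga_eq, mean_sub]; abel
  simp_rw [e]
  refine (mean_norm_sub_mean_sq_le _).trans ((mean_mono h).trans (le_of_eq ?_))
  rw [mean_mul, mean_add, mean_const, tableErr]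

end Saga

lemma mean_norm_sub_prod_sq_le {n m : ℕ} [NeZero n] [NeZero m] {E : Type*} [NormedAddCommGroup E]
    [InnerProductSpace ℝ E] (a : Fin n → E) (b : Fin m → E) (a' b' : E) :
    mean (fun s : Fin n × Fin m => ‖(a s.1 - b s.2) - (a' - b')‖ ^ 2)
      ≤ 2 * mean (fun i => ‖a i - a'‖ ^ 2) + 2 * mean (fun j => ‖b j - b'‖ ^ 2) := by
  have h : ∀ s : Fin n × Fin m, ‖(a s.1 - b s.2) - (a' - b')‖ ^ 2
      ≤ 2 * ‖a s.1 - a'‖ ^ 2 + 2 * ‖b s.2 - b'‖ ^ 2 := by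
    intro s
    rw [sub_sub_sub_comm]
    exact norm_sub_sq_le_two _ _
  refine (mean_mono h).trans (le_of_eq ?_)
  rw [mean_add, mean_mul, mean_mul, mean_prod_fst fun i => ‖a i - a'‖ ^ 2,
    mean_prod_snd fun j => ‖b j - b'‖ ^ 2]

/-- A noisy contractive step towards `c`, followed by a shift of the target. -/
lemma mean_track_le {ι V : Type*} [Fintype ι] [Nonempty ι] [NormedAddCommGroup V]
    [InnerProductSpace ℝ V] (a c c' : V) (X : ι → V) {b t A σ D : ℝ} (ht : 0 < t) (ht1 : t ≤ 1)
    (hmean : ‖a - b • mean X - c‖ ^ 2 ≤ A)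
    (hvar : mean (fun i => ‖X i - mean X‖ ^ 2) ≤ σ) (hc : ‖c - c'‖ ^ 2 ≤ D) :
    mean (fun i => ‖a - b • X i - c'‖ ^ 2) ≤ (1 + t) * A + 2 * b ^ 2 * σ + 2 / t * D := by
  have h1 : ∀ i, ‖a - b • X i - c'‖ ^ 2
      ≤ (1 + t) * ‖(a - c) + (-b) • X i‖ ^ 2 + (1 + t⁻¹) * ‖c - c'‖ ^ 2 := by
    intro i
    have : a - b • X i - c' = ((a - c) + (-b) • X i) + (c - c') := by module
    rw [this]
    exact norm_add_sq_le_young t ht _ _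
  refine (mean_mono h1).trans ?_
  rw [mean_add, mean_mul, mean_const, mean_norm_add_smul_sq]
  have e : (a - c) + (-b) • mean X = a - b • mean X - c := by module
  rw [e]
  have ht' : 1 ≤ t⁻¹ := (one_le_inv₀ ht).2 ht1
  have h2 : (1 + t⁻¹) * ‖c - c'‖ ^ 2 ≤ 2 / t * D := by
    rw [div_eq_mul_inv]
    gcongr
    linarith
  have h0 : 0 ≤ mean (fun i => ‖X i - mean X‖ ^ 2) := mean_nonneg fun i => sq_nonneg _
  have h3 : (1 + t) * ((-b) ^ 2 * mean (fun i => ‖X i - mean X‖ ^ 2)) ≤ 2 * b ^ 2 * σ := by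
    rw [neg_sq, mul_assoc]
    gcongr
    linarith
  have h4 : (1 + t) * ‖a - b • mean X - c‖ ^ 2 ≤ (1 + t) * A := by gcongr
  linarith

lemma tableErr_step_le {ι : Type*} [Fintype ι] [DecidableEq ι] [Nonempty ι] {σ : Type*} [Fintype σ]
    [Nonempty σ] (q : σ → ι) (hq : ∀ h : ι → ℝ, mean (fun s => h (q s)) = mean h)
    (u : Triple dx dy) (u' : σ → Triple dx dy) (w : ι → Triple dx dy) :
    mean (fun s => tableErr (u' s) (Function.update w (q s) u))
      ≤ (1 - 1 / (2 * Fintype.card ι)) * tableErr u w + 5 * mean (fun s => (u' s).sqDist u)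
        + 4 * Fintype.card ι * (‖mean fun s => (u' s).x - u.x‖ ^ 2
          + ‖mean fun s => (u' s).y - u.y‖ ^ 2 + ‖mean fun s => (u' s).z - u.z‖ ^ 2) := by
  have hx := memory_recursion q hq (fun i => u.x - (w i).x) (fun s => (u' s).x - u.x)
  have hy := memory_recursion q hq (fun i => u.y - (w i).y) (fun s => (u' s).y - u.y)
  have hz := memory_recursion q hq (fun i => u.z - (w i).z) (fun s => (u' s).z - u.z)
  -- A refreshed entry equals the old point, so its new displacement is the move alone. This is the
  -- form of `memory_recursion`, coordinate by coordinate.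
  have e : mean (fun s => tableErr (u' s) (Function.update w (q s) u))
      = mean (fun s => mean fun i => ‖(u' s).x - u.x + if i = q s then 0 else u.x - (w i).x‖ ^ 2)
      + mean (fun s => mean fun i => ‖(u' s).y - u.y + if i = q s then 0 else u.y - (w i).y‖ ^ 2)
      + mean (fun s => mean fun i =>
        ‖(u' s).z - u.z + if i = q s then 0 else u.z - (w i).z‖ ^ 2) := by
    simp_rw [← mean_add]
    congr 1
    funext s
    rw [tableErr]
    congr 1
    funext i
    rw [Triple.sqDist, Function.update_apply]
    split_ifs <;> simp
  rw [e]
  unfold tableErr Triple.sqDist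
  simp_rw [mean_add]
  linarith

/-! ### One-step recursions for the errors -/

/-- The direction `v^x_k` that iteration `k` uses. -/
def State.dir (S : State dx dy n m) (θ : Params) : Vec dx := (1 - θ.ρ) • S.v + θ.ρ • S.D

namespace FiniteSumBilevel

/-- The squared error of the direction `v^x_k`. -/
def dirErr (B : FiniteSumBilevel dx dy n m) (θ : Params) (S : State dx dy n m) : ℝ :=
  ‖S.dir θ - B.hyperGrad S.u.x‖ ^ 2

lemma dirErr_nonneg (B : FiniteSumBilevel dx dy n m) (θ : Params) (S : State dx dy n m) :
    0 ≤ B.dirErr θ S := sq_nonneg _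

variable {B : FiniteSumBilevel dx dy n m}
namespace Regular

variable {K : ℝ} (hB : B.Regular K)
include hB

lemma neZero_n : NeZero n := ⟨hB.n_pos.ne'⟩
lemma neZero_m : NeZero m := ⟨hB.m_pos.ne'⟩

lemma mean_estX (w : Memory dx dy n m) (u : Triple dx dy) : mean (B.estX w u) = B.dirX u := by
  have := hB.neZero_n
  have := hB.neZero_m
  unfold estX
  rw [mean_sub, mean_prod_fst (saga (fun i u => grad1 (B.F i) (joint u.x u.y)) w.f u),
    mean_prod_snd (saga (fun j u => hess12 (B.G j) (joint u.x u.y) u.z) w.g u), mean_saga,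
    mean_saga,
    hB.mean_grad1_F, hB.mean_hess12_G, dirX]

lemma mean_estY (w : Memory dx dy n m) (u : Triple dx dy) : mean (B.estY w u) = B.dirY u := by
  have := hB.neZero_n
  have := hB.neZero_m
  unfold estY
  rw [mean_prod_snd (saga (fun j u => grad2 (B.G j) (joint u.x u.y)) w.g u), mean_saga,
    hB.mean_grad2_G, dirY]

lemma mean_estZ (w : Memory dx dy n m) (u : Triple dx dy) : mean (B.estZ w u) = B.dirZ u := by
  have := hB.neZero_n
  have := hB.neZero_m
  unfold estZ
  rw [mean_sub, mean_prod_fst (saga (fun i u => grad2 (B.F i) (joint u.x u.y)) w.f u),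
    mean_prod_snd (saga (fun j u => hess22 (B.G j) (joint u.x u.y) u.z) w.g u), mean_saga,
    mean_saga,
    hB.mean_grad2_F, hB.mean_hess22_G, dirZ]

lemma var_estX_le (w : Memory dx dy n m) (u : Triple dx dy) :
    mean (fun s => ‖B.estX w u s - B.dirX u‖ ^ 2) ≤ lipConst K * (w.err u + B.zErr u) := by
  have := hB.neZero_n
  have := hB.neZero_m
  have h1 := var_saga_le (fun i u => grad1 (B.F i) (joint u.x u.y)) w.f u
    (fun i => hB.grad1_F_sub_sq_le i u (w.f i))
  have h2 := var_saga_le (fun j u => hess12 (B.G j) (joint u.x u.y) u.z) w.g u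
    (fun j => hB.hess12_G_sub_sq_le j u (w.g j))
  rw [hB.mean_grad1_F] at h1
  rw [hB.mean_hess12_G] at h2
  unfold estX dirX
  refine (mean_norm_sub_prod_sq_le _ _ _ _).trans ?_
  rw [Memory.err]
  nlinarith [tableErr_nonneg u w.f, tableErr_nonneg u w.g, hB.one_le_lipConst]

lemma var_estY_le (w : Memory dx dy n m) (u : Triple dx dy) :
    mean (fun s => ‖B.estY w u s - B.dirY u‖ ^ 2) ≤ lipConst K * (w.err u + B.zErr u) := by
  have := hB.neZero_n
  have := hB.neZero_m
  have h2 := var_saga_le (fun j u => grad2 (B.G j) (joint u.x u.y)) w.g u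
    (fun j => hB.grad2_G_sub_sq_le j u (w.g j))
  rw [hB.mean_grad2_G] at h2
  unfold estY dirY
  rw [mean_prod_snd fun j => ‖saga (fun j u => grad2 (B.G j) (joint u.x u.y)) w.g u j
    - grad2 B.g (joint u.x u.y)‖ ^ 2]
  refine h2.trans ?_
  rw [Memory.err]
  nlinarith [tableErr_nonneg u w.f, tableErr_nonneg u w.g, hB.one_le_lipConst, B.zErr_nonneg u]

lemma var_estZ_le (w : Memory dx dy n m) (u : Triple dx dy) :
    mean (fun s => ‖B.estZ w u s - B.dirZ u‖ ^ 2) ≤ lipConst K * (w.err u + B.zErr u) := by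
  have := hB.neZero_n
  have := hB.neZero_m
  have h1 := var_saga_le (fun i u => grad2 (B.F i) (joint u.x u.y)) w.f u
    (fun i => hB.grad2_F_sub_sq_le i u (w.f i))
  have h2 := var_saga_le (fun j u => hess22 (B.G j) (joint u.x u.y) u.z) w.g u
    (fun j => hB.hess22_G_sub_sq_le j u (w.g j))
  rw [hB.mean_grad2_F] at h1
  rw [hB.mean_hess22_G] at h2
  unfold estZ dirZ
  have h3 := mean_norm_sub_prod_sq_le
    (fun i => -saga (fun i u => grad2 (B.F i) (joint u.x u.y)) w.f u i)
    (fun j => -saga (fun j u => hess22 (B.G j) (joint u.x u.y) u.z) w.g u j)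
    (-grad2 B.f (joint u.x u.y)) (-hess22 B.g (joint u.x u.y) u.z)
  simp only [neg_sub_neg] at h3
  simp_rw [norm_sub_rev (grad2 B.f (joint u.x u.y)),
    norm_sub_rev (hess22 B.g (joint u.x u.y) u.z)] at h3
  refine h3.trans ?_
  rw [Memory.err]
  nlinarith [tableErr_nonneg u w.f, tableErr_nonneg u w.g, hB.one_le_lipConst]

variable (θ : Params) (S : State dx dy n m)

/-- Polarization rewrites -α⟨∇H, v⟩ through the squares of ∇H, v and v - ∇H. The term -(α/2)‖v‖² is
kept: it pays for everything that the move of x causes in the other recursions. -/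
lemma H_step_le (s : Fin n × Fin m) :
    B.H (B.step θ S s).u.x ≤ B.H S.u.x - θ.α / 2 * ‖B.hyperGrad S.u.x‖ ^ 2
      - θ.α / 2 * ‖S.dir θ‖ ^ 2 + θ.α / 2 * B.dirErr θ S
      + lipConst K * θ.α ^ 2 * ‖S.dir θ‖ ^ 2 := by
  have h := hB.H_le S.u.x (S.u.x - θ.α • S.dir θ)
  have e : S.u.x - θ.α • S.dir θ - S.u.x = -(θ.α • S.dir θ) := by abel
  rw [e, inner_neg_right, inner_smul_right, norm_neg, norm_smul, mul_pow, Real.norm_eq_abs,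
    sq_abs] at h
  have h2 : B.dirErr θ S = ‖S.dir θ‖ ^ 2 - 2 * inner ℝ (B.hyperGrad S.u.x) (S.dir θ)
      + ‖B.hyperGrad S.u.x‖ ^ 2 := by
    rw [dirErr, norm_sub_sq_real, real_inner_comm]
  rw [h2]
  change B.H (S.u.x - θ.α • S.dir θ) ≤ _
  linarith

/-- Because the estimate enters the direction one iteration late, the next x does not depend on the
current draw. The noise then comes only from the factor ρ times the estimator, and the decomposition
of bias and variance is exact. -/
lemma mean_dirErr_step_le (hρ : 0 < θ.ρ) (hρ1 : θ.ρ ≤ 1) :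
    mean (fun s => B.dirErr θ (B.step θ S s)) ≤ (1 - θ.ρ) * B.dirErr θ S
      + 2 * θ.ρ * lipConst K * (B.yErr S.u + B.zErr S.u)
      + 2 * lipConst K * θ.α ^ 2 / θ.ρ * ‖S.dir θ‖ ^ 2
      + θ.ρ ^ 2 * (lipConst K * (S.w.err S.u + B.zErr S.u)) := by
  have := hB.neZero_n
  have := hB.neZero_m
  set x' := S.u.x - θ.α • S.dir θ with hx'
  have e1 : ∀ s, B.dirErr θ (B.step θ S s)
      = ‖((1 - θ.ρ) • S.dir θ - B.hyperGrad x') + θ.ρ • B.estX S.w S.u s‖ ^ 2 := by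
    intro s
    rw [sub_add_eq_add_sub]; rfl
  simp_rw [e1]
  rw [mean_norm_add_smul_sq, hB.mean_estX]
  have h1 := mul_le_mul_of_nonneg_left (hB.var_estX_le S.w S.u) (sq_nonneg θ.ρ)
  -- The drift of ∇H is placed inside the convex combination with factor ρ⁻¹. Convexity of the
  -- square then keeps the full contraction 1 - ρ, and the drift costs α²/ρ.
  have e2 : ((1 - θ.ρ) • S.dir θ - B.hyperGrad x') + θ.ρ • B.dirX S.u
      = (1 - θ.ρ) • (S.dir θ - B.hyperGrad S.u.x) + θ.ρ • ((B.dirX S.u - B.hyperGrad S.u.x)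
        + θ.ρ⁻¹ • (B.hyperGrad S.u.x - B.hyperGrad x')) := by
    have : θ.ρ • θ.ρ⁻¹ • (B.hyperGrad S.u.x - B.hyperGrad x')
        = B.hyperGrad S.u.x - B.hyperGrad x' := by
      rw [smul_smul, mul_inv_cancel₀ hρ.ne', one_smul]
    rw [smul_add, this]
    module
  have h2 := norm_convex_comb_sq_le θ.ρ hρ.le hρ1 (S.dir θ - B.hyperGrad S.u.x)
    ((B.dirX S.u - B.hyperGrad S.u.x) + θ.ρ⁻¹ • (B.hyperGrad S.u.x - B.hyperGrad x'))
  have h3 := norm_add_sq_le_two (B.dirX S.u - B.hyperGrad S.u.x)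
    (θ.ρ⁻¹ • (B.hyperGrad S.u.x - B.hyperGrad x'))
  have h4 := hB.dirX_sub_sq_le S.u
  have h5 : ‖θ.ρ⁻¹ • (B.hyperGrad S.u.x - B.hyperGrad x')‖ ^ 2
      ≤ θ.ρ⁻¹ ^ 2 * (lipConst K * (θ.α ^ 2 * ‖S.dir θ‖ ^ 2)) := by
    rw [norm_smul, mul_pow, Real.norm_eq_abs, sq_abs]
    have := hB.hyperGrad_sub_sq_le S.u.x x'
    rw [hx', sub_sub_cancel, norm_smul, mul_pow, Real.norm_eq_abs, sq_abs] at this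
    gcongr
  have h6 := mul_le_mul_of_nonneg_left (h3.trans (add_le_add
    (mul_le_mul_of_nonneg_left h4 zero_le_two) (mul_le_mul_of_nonneg_left h5 zero_le_two))) hρ.le
  have e3 : θ.ρ * (2 * (lipConst K * (B.yErr S.u + B.zErr S.u))
      + 2 * (θ.ρ⁻¹ ^ 2 * (lipConst K * (θ.α ^ 2 * ‖S.dir θ‖ ^ 2))))
      = 2 * θ.ρ * lipConst K * (B.yErr S.u + B.zErr S.u)
        + 2 * lipConst K * θ.α ^ 2 / θ.ρ * ‖S.dir θ‖ ^ 2 := by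
    field_simp
  rw [e3] at h6
  rw [e2]
  change _ ≤ (1 - θ.ρ) * B.dirErr θ S + _ at h2
  linarith

lemma mean_yErr_step_le (hβ : 0 < θ.β) (hβ1 : θ.β ≤ 1) (hβL : θ.β * lipConst K ≤ K⁻¹) :
    mean (fun s => B.yErr (B.step θ S s).u) ≤ (1 - θ.β * K⁻¹ / 2) * B.yErr S.u
      + 2 * θ.β ^ 2 * (lipConst K * (S.w.err S.u + B.zErr S.u))
      + 4 * K / θ.β * (lipConst K * (θ.α ^ 2 * ‖S.dir θ‖ ^ 2)) := by
  have := hB.neZero_n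
  have := hB.neZero_m
  have hK := hB.pos
  have hKi : K⁻¹ ≤ 1 := inv_le_one_of_one_le₀ hB.one_le
  have hKi0 : 0 < K⁻¹ := inv_pos.2 hK
  have hY := B.yErr_nonneg S.u
  have hm : ‖S.u.y - θ.β • mean (B.estY S.w S.u) - B.yStar S.u.x‖ ^ 2
      ≤ (1 - θ.β * K⁻¹) * B.yErr S.u := by
    have e : S.u.y - θ.β • B.dirY S.u - B.yStar S.u.x
        = (S.u.y - B.yStar S.u.x) - θ.β • B.dirY S.u := by abel
    rw [hB.mean_estY, e, norm_sub_sq_real, inner_smul_right, norm_smul, mul_pow, Real.norm_eq_abs,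
      sq_abs, real_inner_comm]
    have h1 := mul_le_mul_of_nonneg_left (hB.dirY_inner S.u) hβ.le
    have h2 := mul_le_mul_of_nonneg_left (hB.dirY_sq_le S.u) (sq_nonneg θ.β)
    have h3 := mul_le_mul_of_nonneg_left (mul_le_mul_of_nonneg_right hβL hY) hβ.le
    change B.yErr S.u - _ + _ ≤ _
    nlinarith
  have hc : ‖B.yStar S.u.x - B.yStar (S.u.x - θ.α • S.dir θ)‖ ^ 2
      ≤ lipConst K * (θ.α ^ 2 * ‖S.dir θ‖ ^ 2) := by
    have := hB.yStar_sub_sq_le S.u.x (S.u.x - θ.α • S.dir θ)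
    rwa [sub_sub_cancel, norm_smul, mul_pow, Real.norm_eq_abs, sq_abs] at this
  have hv := hB.var_estY_le S.w S.u
  rw [← hB.mean_estY S.w] at hv
  -- With this t, half of the contraction β/K pays for the shift of the target, since (1 + t)(1 -
  -- 2t) ≤ 1 - t.
  have h := mean_track_le S.u.y (B.yStar S.u.x) (B.yStar (S.u.x - θ.α • S.dir θ))
    (B.estY S.w S.u) (t := θ.β * K⁻¹ / 2) (by positivity) (by nlinarith) hm hv hc
  change mean (fun s => B.yErr (B.step θ S s).u) ≤ _ at h
  refine h.trans ?_
  have e : 2 / (θ.β * K⁻¹ / 2) = 4 * K / θ.β := by field_simp; norm_num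
  rw [e]
  have : (1 + θ.β * K⁻¹ / 2) * ((1 - θ.β * K⁻¹) * B.yErr S.u)
      ≤ (1 - θ.β * K⁻¹ / 2) * B.yErr S.u := by
    rw [← mul_assoc]
    refine mul_le_mul_of_nonneg_right ?_ hY
    nlinarith [mul_pos hβ hKi0]
  linarith

lemma mean_zErr_step_le (hγ : 0 < θ.γ) (hγ1 : θ.γ ≤ 1) (hγL : 2 * θ.γ * lipConst K ≤ K⁻¹) :
    mean (fun s => B.zErr (B.step θ S s).u) ≤ (1 - θ.γ * K⁻¹ / 4) * B.zErr S.u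
      + 4 * θ.γ * lipConst K * B.yErr S.u
      + 2 * θ.γ ^ 2 * (lipConst K * (S.w.err S.u + B.zErr S.u))
      + 8 * K / θ.γ * (lipConst K * (θ.α ^ 2 * ‖S.dir θ‖ ^ 2)) := by
  have := hB.neZero_n
  have := hB.neZero_m
  have hK := hB.pos
  have hL := hB.one_le_lipConst
  have hKi : K⁻¹ ≤ 1 := inv_le_one_of_one_le₀ hB.one_le
  have hKi0 : 0 < K⁻¹ := inv_pos.2 hK
  have hY := B.yErr_nonneg S.u
  have hZ := B.zErr_nonneg S.u
  have hm : ‖S.u.z - θ.γ • mean (B.estZ S.w S.u) - B.zStar S.u.x‖ ^ 2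
      ≤ (1 - θ.γ * K⁻¹ / 2) * B.zErr S.u + 2 * θ.γ * lipConst K * B.yErr S.u := by
    have e : S.u.z - θ.γ • B.dirZ S.u - B.zStar S.u.x
        = (S.u.z - B.zStar S.u.x) - θ.γ • B.dirZ S.u := by abel
    rw [hB.mean_estZ, e, norm_sub_sq_real, inner_smul_right, norm_smul, mul_pow, Real.norm_eq_abs,
      sq_abs, real_inner_comm]
    have h1 := mul_le_mul_of_nonneg_left (hB.dirZ_inner S.u) hγ.le
    have h2 := mul_le_mul_of_nonneg_left (hB.dirZ_sq_le S.u) (sq_nonneg θ.γ)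
    have h3 := mul_le_mul_of_nonneg_left (mul_le_mul_of_nonneg_right hγL hZ) hγ.le
    have h4 : θ.γ ^ 2 * (lipConst K * B.yErr S.u) ≤ θ.γ * (lipConst K * B.yErr S.u) := by
      gcongr
      nlinarith
    change B.zErr S.u - _ + _ ≤ _
    nlinarith
  have hc : ‖B.zStar S.u.x - B.zStar (S.u.x - θ.α • S.dir θ)‖ ^ 2
      ≤ lipConst K * (θ.α ^ 2 * ‖S.dir θ‖ ^ 2) := by
    have := hB.zStar_sub_sq_le S.u.x (S.u.x - θ.α • S.dir θ)
    rwa [sub_sub_cancel, norm_smul, mul_pow, Real.norm_eq_abs, sq_abs] at this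
  have hv := hB.var_estZ_le S.w S.u
  rw [← hB.mean_estZ S.w] at hv
  have h := mean_track_le S.u.z (B.zStar S.u.x) (B.zStar (S.u.x - θ.α • S.dir θ))
    (B.estZ S.w S.u) (t := θ.γ * K⁻¹ / 4) (by positivity) (by nlinarith) hm hv hc
  change mean (fun s => B.zErr (B.step θ S s).u) ≤ _ at h
  refine h.trans ?_
  have e : 2 / (θ.γ * K⁻¹ / 4) = 8 * K / θ.γ := by field_simp; norm_num
  rw [e]
  have h1 : (1 + θ.γ * K⁻¹ / 4) * ((1 - θ.γ * K⁻¹ / 2) * B.zErr S.u)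
      ≤ (1 - θ.γ * K⁻¹ / 4) * B.zErr S.u := by
    rw [← mul_assoc]
    refine mul_le_mul_of_nonneg_right ?_ hZ
    nlinarith [mul_pos hγ hKi0]
  have h2 : (1 + θ.γ * K⁻¹ / 4) * (2 * θ.γ * lipConst K * B.yErr S.u)
      ≤ 2 * (2 * θ.γ * lipConst K * B.yErr S.u) := by
    gcongr
    nlinarith
  linarith

/-- The step in x carries no noise, so the variances come only from y and z, and they avoid the
factor n + m. The mean moves do carry it, but in y and z they are controlled by the tracking errors.
-/
lemma mean_memErr_step_le :
    mean (fun s => (B.step θ S s).w.err (B.step θ S s).u)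
      ≤ (1 - 1 / (2 * (n + m : ℝ))) * S.w.err S.u
        + 10 * (θ.β ^ 2 + θ.γ ^ 2) * (lipConst K * (S.w.err S.u + B.zErr S.u))
        + 10 * (n + m : ℝ) * (θ.α ^ 2 * ‖S.dir θ‖ ^ 2
          + (θ.β ^ 2 + θ.γ ^ 2) * (lipConst K * (B.yErr S.u + B.zErr S.u))) := by
  have := hB.neZero_n
  have := hB.neZero_m
  have hn : (1 : ℝ) ≤ n := by exact_mod_cast hB.n_pos
  have hm : (1 : ℝ) ≤ m := by exact_mod_cast hB.m_pos
  have hL := hB.one_le_lipConst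
  set u' : Fin n × Fin m → Triple dx dy := fun s => (B.step θ S s).u with hu'
  have hf := tableErr_step_le (ι := Fin n) (σ := Fin n × Fin m) Prod.fst (fun h => mean_prod_fst h)
    S.u u' S.w.f
  have hg := tableErr_step_le (ι := Fin m) (σ := Fin n × Fin m) Prod.snd (fun h => mean_prod_snd h)
    S.u u' S.w.g
  rw [Fintype.card_fin] at hf hg
  have ex : ∀ s, (u' s).x - S.u.x = -(θ.α • S.dir θ) := fun s => sub_sub_cancel_left _ _
  have ey : ∀ s, (u' s).y - S.u.y = (-θ.β) • B.estY S.w S.u s := fun s => by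
    rw [neg_smul]; exact sub_sub_cancel_left _ _
  have ez : ∀ s, (u' s).z - S.u.z = (-θ.γ) • B.estZ S.w S.u s := fun s => by
    rw [neg_smul]; exact sub_sub_cancel_left _ _
  have mx : ‖mean fun s => (u' s).x - S.u.x‖ ^ 2 = θ.α ^ 2 * ‖S.dir θ‖ ^ 2 := by
    simp_rw [ex]
    rw [mean_const, norm_neg, norm_smul, mul_pow, Real.norm_eq_abs, sq_abs]
  have my : ‖mean fun s => (u' s).y - S.u.y‖ ^ 2 = θ.β ^ 2 * ‖B.dirY S.u‖ ^ 2 := by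
    simp_rw [ey]
    rw [mean_smul, hB.mean_estY, norm_smul, mul_pow, Real.norm_eq_abs, sq_abs, neg_sq]
  have mz : ‖mean fun s => (u' s).z - S.u.z‖ ^ 2 = θ.γ ^ 2 * ‖B.dirZ S.u‖ ^ 2 := by
    simp_rw [ez]
    rw [mean_smul, hB.mean_estZ, norm_smul, mul_pow, Real.norm_eq_abs, sq_abs, neg_sq]
  have hd : mean (fun s => (u' s).sqDist S.u)
      = θ.α ^ 2 * ‖S.dir θ‖ ^ 2
        + θ.β ^ 2 * (‖B.dirY S.u‖ ^ 2 + mean (fun s => ‖B.estY S.w S.u s - B.dirY S.u‖ ^ 2))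
        + θ.γ ^ 2 * (‖B.dirZ S.u‖ ^ 2 + mean (fun s => ‖B.estZ S.w S.u s - B.dirZ S.u‖ ^ 2)) := by
    unfold Triple.sqDist
    simp_rw [ex, ey, ez, norm_neg, norm_smul, mul_pow, norm_neg, Real.norm_eq_abs, sq_abs]
    rw [mean_add, mean_add, mean_const, mean_mul, mean_mul, mean_norm_sq (B.estY S.w S.u),
      mean_norm_sq (B.estZ S.w S.u), hB.mean_estY, hB.mean_estZ]
  have vy := mul_le_mul_of_nonneg_left (hB.var_estY_le S.w S.u) (sq_nonneg θ.β)
  have vz := mul_le_mul_of_nonneg_left (hB.var_estZ_le S.w S.u) (sq_nonneg θ.γ)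
  have dY : θ.β ^ 2 * ‖B.dirY S.u‖ ^ 2 ≤ θ.β ^ 2 * (lipConst K * (B.yErr S.u + B.zErr S.u)) := by
    have := hB.dirY_sq_le S.u
    have := B.zErr_nonneg S.u
    gcongr
    nlinarith
  have dZ := mul_le_mul_of_nonneg_left (hB.dirZ_sq_le S.u) (sq_nonneg θ.γ)
  have e : mean (fun s => (B.step θ S s).w.err (B.step θ S s).u)
      = mean (fun s => tableErr (u' s) (Function.update S.w.f s.1 S.u))
        + mean (fun s => tableErr (u' s) (Function.update S.w.g s.2 S.u)) := by
    rw [← mean_add]; rfl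
  have cf : (1 - 1 / (2 * (n : ℝ))) * tableErr S.u S.w.f
      ≤ (1 - 1 / (2 * (n + m : ℝ))) * tableErr S.u S.w.f := by
    have := tableErr_nonneg S.u S.w.f
    gcongr
    linarith
  have cg : (1 - 1 / (2 * (m : ℝ))) * tableErr S.u S.w.g
      ≤ (1 - 1 / (2 * (n + m : ℝ))) * tableErr S.u S.w.g := by
    have := tableErr_nonneg S.u S.w.g
    gcongr
    linarith
  rw [e]
  rw [hd, mx, my, mz] at hf hg
  set P : ℝ := θ.α ^ 2 * ‖S.dir θ‖ ^ 2 + θ.β ^ 2 * ‖B.dirY S.u‖ ^ 2 + θ.γ ^ 2 * ‖B.dirZ S.u‖ ^ 2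
    with hP
  have hP0 : 0 ≤ P := by positivity
  have hP1 : P ≤ θ.α ^ 2 * ‖S.dir θ‖ ^ 2
      + (θ.β ^ 2 + θ.γ ^ 2) * (lipConst K * (B.yErr S.u + B.zErr S.u)) := by linarith
  -- 10 ≤ 6 (n + m), because n + m ≥ 2.
  have hP2 : 10 * P + 4 * (n + m) * P ≤ 10 * (n + m : ℝ) * (θ.α ^ 2 * ‖S.dir θ‖ ^ 2
      + (θ.β ^ 2 + θ.γ ^ 2) * (lipConst K * (B.yErr S.u + B.zErr S.u))) := by
    calc 10 * P + 4 * (n + m) * P ≤ 10 * (n + m : ℝ) * P := by nlinarith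
      _ ≤ _ := by gcongr
  have e2 : (1 - 1 / (2 * (n + m : ℝ))) * S.w.err S.u
      = (1 - 1 / (2 * (n + m : ℝ))) * tableErr S.u S.w.f
        + (1 - 1 / (2 * (n + m : ℝ))) * tableErr S.u S.w.g := by
    rw [Memory.err]; ring
  rw [e2]
  linarith

end Regular
end FiniteSumBilevel

/-! ### Constants and decrease of the Lyapunov function -/

/-- Constants for which the Lyapunov function decreases: `κ s`, `s`, `s`, `s` are the constants of
the step sizes, `b`, `c` weights of the Lyapunov function, `L` the Lipschitz constant and `K⁻¹` the
modulus of strong convexity. -/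
structure LyapunovConstants (K L κ s b c : ℝ) : Prop where
  κ_pos : 0 < κ
  s_pos : 0 < s
  b_pos : 0 < b
  c_pos : 0 < c
  κ_le : κ * (3 * L + (4 * b + 8 * c) * K * L + 10) ≤ 1 / 2
  κ_le_one : κ ≤ 1
  s_le_one : s ≤ 1
  s_L : 80 * s * L ≤ 1
  s_L_K : 2 * s * L * K ≤ 1
  s_L_bc : s * L * (1 + 2 * b + 2 * c) ≤ 1 / 4
  b_eq : b = 2 * K * (3 * L + 4 * L * c)
  c_eq : c = 20 * K * L

/-- The order of choice avoids circularity: c depends on K and L, b on c as well, and the smallness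
conditions on κ and s come last. The sizes n and m do not enter. -/
lemma exists_lyapunovConstants {K L : ℝ} (hK : 1 ≤ K) (hL : 1 ≤ L) :
    ∃ κ s b c, LyapunovConstants K L κ s b c := by
  have hK0 : 0 < K := by linarith
  have hL0 : 0 < L := by linarith
  obtain ⟨c, hc⟩ : ∃ c, c = 20 * K * L := ⟨_, rfl⟩
  have hc0 : 0 < c := by rw [hc]; positivity
  obtain ⟨b, hb⟩ : ∃ b, b = 2 * K * (3 * L + 4 * L * c) := ⟨_, rfl⟩
  have hb0 : 0 < b := by rw [hb]; positivity
  set D : ℝ := 3 * L + (4 * b + 8 * c) * K * L + 10 with hD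
  have hD1 : 1 ≤ D := by
    have : 0 < (4 * b + 8 * c) * K * L := by positivity
    linarith
  set Q : ℝ := 100 * L * K * (1 + 2 * b + 2 * c) with hQ
  have hLK : L ≤ L * K := le_mul_of_one_le_right hL0.le hK
  have h1 : L * K ≤ L * K * (1 + 2 * b + 2 * c) :=
    le_mul_of_one_le_right (by positivity) (by linarith)
  have hQ0 : 0 < Q := by positivity
  have h2 : L * (1 + 2 * b + 2 * c) ≤ L * K * (1 + 2 * b + 2 * c) := by gcongr
  refine ⟨(2 * D)⁻¹, Q⁻¹, b, c, ⟨by positivity, by positivity, hb0, hc0, ?_, ?_, ?_, ?_, ?_, ?_,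
    hb, hc⟩⟩
  · rw [mul_inv, mul_assoc, inv_mul_cancel₀ (by positivity)]; norm_num
  · exact inv_le_one_of_one_le₀ (by linarith)
  · exact inv_le_one_of_one_le₀ (by linarith)
  · rw [mul_comm 80, mul_assoc, inv_mul_le_iff₀ hQ0]; linarith
  · rw [mul_comm 2, mul_assoc, mul_assoc, inv_mul_le_iff₀ hQ0]; linarith
  · rw [mul_assoc, inv_mul_le_iff₀ hQ0]; linarith

/-- These are the final coefficients of ‖v‖², `yErr`, `zErr` and the memory error, after the common
factors κ s τ, κ s τ, κ s τ and κ τ² are removed. The negative parts are, in order, the descent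
term, the contractions weighted by b and c, and the forgetting of the tables. -/
lemma LyapunovConstants.coefficients_nonpos {K L κ s b c τ W : ℝ}
    (h : LyapunovConstants K L κ s b c) (hK : 0 < K) (hL : 1 ≤ L) (hτ : 0 < τ) (hτ1 : τ ≤ 1)
    (hW1 : W ≤ 1) :
    -(1 / 2) + L * κ * s * τ + 2 * L * κ ^ 2 + (4 * b + 8 * c) * K * L * κ ^ 2
      + 10 * κ ^ 2 * s ≤ 0 ∧
    2 * L - b * K⁻¹ / 2 + 4 * L * c + 20 * s * L ≤ 0 ∧
    2 * L + s * L * (1 + 2 * b + 2 * c) * τ - c * K⁻¹ / 4 + 20 * W * s * τ * L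
      + 20 * s * L ≤ 0 ∧
    s * (s * L * (1 + 2 * b + 2 * c)) + 20 * W * s ^ 2 * L - 1 / 2 ≤ 0 := by
  obtain ⟨hκ0, hs0, hb0, hc0, hκ, hκ1, hs1, hsL, hsLK, hsbc, hb, hc⟩ := h
  have hL0 : 0 < L := by linarith
  have hst : s * τ ≤ s := mul_le_of_le_one_right hs0.le hτ1
  have cV : -(1 / 2) + L * κ * s * τ + 2 * L * κ ^ 2 + (4 * b + 8 * c) * K * L * κ ^ 2
      + 10 * κ ^ 2 * s ≤ 0 := by
    have hκκ : κ ^ 2 ≤ κ := by rw [sq]; exact mul_le_of_le_one_left hκ0.le hκ1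
    have t1 : L * κ * s * τ ≤ L * κ := by
      have : L * κ * (s * τ) ≤ L * κ * 1 := by gcongr; linarith
      linarith
    have t2 : 2 * L * κ ^ 2 ≤ 2 * L * κ := by gcongr
    have t3 : (4 * b + 8 * c) * K * L * κ ^ 2 ≤ (4 * b + 8 * c) * K * L * κ := by gcongr
    have t4 : 10 * κ ^ 2 * s ≤ 10 * κ := by
      have : κ ^ 2 * s ≤ κ * 1 := by gcongr
      linarith
    linarith
  have cY : 2 * L - b * K⁻¹ / 2 + 4 * L * c + 20 * s * L ≤ 0 := by
    have : b * K⁻¹ = 2 * (3 * L + 4 * L * c) := by rw [hb]; field_simp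
    rw [this]; linarith
  have hsLτ : s * L * (1 + 2 * b + 2 * c) * τ ≤ 1 / 4 := by
    have : s * L * (1 + 2 * b + 2 * c) * τ ≤ s * L * (1 + 2 * b + 2 * c) * 1 := by gcongr
    linarith
  have hWτ : 20 * W * s * τ * L ≤ 1 / 4 := by
    have : 20 * s * L * (W * τ) ≤ 20 * s * L * 1 := by
      gcongr
      exact mul_le_one₀ hW1 hτ.le hτ1
    linarith
  have cZ : 2 * L + s * L * (1 + 2 * b + 2 * c) * τ - c * K⁻¹ / 4 + 20 * W * s * τ * L
      + 20 * s * L ≤ 0 := by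
    have : c * K⁻¹ = 20 * L := by rw [hc]; field_simp
    rw [this]; linarith
  have cE : s * (s * L * (1 + 2 * b + 2 * c)) + 20 * W * s ^ 2 * L - 1 / 2 ≤ 0 := by
    have t1 : s * (s * L * (1 + 2 * b + 2 * c)) ≤ 1 / 4 := by
      have : s * (s * L * (1 + 2 * b + 2 * c)) ≤ 1 * (s * L * (1 + 2 * b + 2 * c)) := by gcongr
      linarith
    have t2 : 20 * W * s ^ 2 * L ≤ 1 / 4 := by
      have : 20 * s * L * (W * s) ≤ 20 * s * L * 1 := by
        gcongr
        exact mul_le_one₀ hW1 hs0.le hs1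
      linarith
    linarith
  exact ⟨cV, cY, cZ, cE⟩

/-- The scalar recursions of one iteration combined with the weights of the Lyapunov function. -/
lemma lyapunov_combination {K L κ s b c τ N A V M Y Z E H H' M' Y' Z' E' : ℝ}
    (h : LyapunovConstants K L κ s b c) (hK : 0 < K) (hL : 1 ≤ L) (hτ : 0 < τ) (hτ1 : τ ≤ 1)
    (hN0 : 0 < N) (hN : N ^ 2 * τ ^ 3 = 1) (hV0 : 0 ≤ V) (hM0 : 0 ≤ M) (hY0 : 0 ≤ Y) (hZ0 : 0 ≤ Z)
    (hE0 : 0 ≤ E)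
    (dH : H' ≤ H - κ * s * τ / 2 * A - κ * s * τ / 2 * V + κ * s * τ / 2 * M
      + L * (κ * s * τ) ^ 2 * V)
    (dM : M' ≤ (1 - s * τ) * M + 2 * (s * τ) * L * (Y + Z)
      + 2 * L * (κ * s * τ) ^ 2 / (s * τ) * V + (s * τ) ^ 2 * (L * (E + Z)))
    (dY : Y' ≤ (1 - s * τ * K⁻¹ / 2) * Y + 2 * (s * τ) ^ 2 * (L * (E + Z))
      + 4 * K / (s * τ) * (L * ((κ * s * τ) ^ 2 * V)))
    (dZ : Z' ≤ (1 - s * τ * K⁻¹ / 4) * Z + 4 * (s * τ) * L * Y + 2 * (s * τ) ^ 2 * (L * (E + Z))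
      + 8 * K / (s * τ) * (L * ((κ * s * τ) ^ 2 * V)))
    (dE : E' ≤ (1 - 1 / (2 * N)) * E + 10 * ((s * τ) ^ 2 + (s * τ) ^ 2) * (L * (E + Z))
      + 10 * N * ((κ * s * τ) ^ 2 * V + ((s * τ) ^ 2 + (s * τ) ^ 2) * (L * (Y + Z)))) :
    H' + κ * (M' + b * Y' + c * Z' + N * τ ^ 2 * E')
      ≤ H + κ * (M + b * Y + c * Z + N * τ ^ 2 * E) - κ * s * τ / 2 * A := by
  have hκ0 := h.κ_pos
  have hs0 := h.s_pos
  have hb0 := h.b_pos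
  have hc0 := h.c_pos
  obtain ⟨W, hW⟩ : ∃ W, W = N * τ ^ 2 := ⟨_, rfl⟩
  rw [← hW]
  have hW0 : 0 < W := by rw [hW]; positivity
  have hW1 : W ≤ 1 := by
    have : W ^ 2 ≤ 1 := by
      calc W ^ 2 = (N ^ 2 * τ ^ 3) * τ := by rw [hW]; ring
        _ ≤ 1 := by rw [hN, one_mul]; exact hτ1
    nlinarith
  have hL0 : 0 < L := by linarith
  have hst : s * τ ≤ s := mul_le_of_le_one_right hs0.le hτ1
  -- The drift costs α²/ρ, α²/β, α²/γ are of order τ with an extra factor κ compared with α. A small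
  -- κ therefore lets -(α/2)‖v‖² absorb them.
  have r1 : (κ * s * τ) ^ 2 / (s * τ) = κ ^ 2 * s * τ := by field_simp
  have dM' : M' ≤ (1 - s * τ) * M + 2 * (s * τ) * L * (Y + Z) + 2 * L * (κ ^ 2 * s * τ) * V
      + (s * τ) ^ 2 * (L * (E + Z)) := by
    refine dM.trans (le_of_eq ?_)
    rw [← r1]; ring
  have dY' : Y' ≤ (1 - s * τ * K⁻¹ / 2) * Y + 2 * (s * τ) ^ 2 * (L * (E + Z))
      + 4 * K * (κ ^ 2 * s * τ) * L * V := by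
    refine dY.trans (le_of_eq ?_)
    rw [← r1]; ring
  have dZ' : Z' ≤ (1 - s * τ * K⁻¹ / 4) * Z + 4 * (s * τ) * L * Y
      + 2 * (s * τ) ^ 2 * (L * (E + Z)) + 8 * K * (κ ^ 2 * s * τ) * L * V := by
    refine dZ.trans (le_of_eq ?_)
    rw [← r1]; ring
  -- The two balances behind τ = N^(-2/3): weighted forgetting is worth τ²/2, the order of the
  -- variances, and the weighted drift W N τ² equals τ.
  have w1 : W * (1 / (2 * N)) = τ ^ 2 / 2 := by rw [hW]; field_simp
  have w2 : W * N * τ = 1 := by rw [← hN, hW]; ring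
  have dE' : W * E' ≤ W * E - τ ^ 2 / 2 * E + 20 * W * (s * τ) ^ 2 * (L * (E + Z))
      + 10 * τ * (κ * s) ^ 2 * V + 20 * τ * s ^ 2 * (L * (Y + Z)) := by
    refine (mul_le_mul_of_nonneg_left dE hW0.le).trans (le_of_eq ?_)
    calc _ = W * E - W * (1 / (2 * N)) * E + 20 * W * (s * τ) ^ 2 * (L * (E + Z))
        + (W * N * τ) * (10 * τ * (κ * s) ^ 2 * V + 20 * τ * s ^ 2 * (L * (Y + Z))) := by ring
      _ = _ := by rw [w1, w2]; ring
  obtain ⟨cV, cY, cZ, cE⟩ := h.coefficients_nonpos hK hL hτ hτ1 hW1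
  have total : M' + b * Y' + c * Z' + W * E'
      ≤ (M + b * Y + c * Z + W * E) - s * τ * M
        + s * τ * (2 * L - b * K⁻¹ / 2 + 4 * L * c + 20 * s * L) * Y
        + s * τ * (2 * L + s * L * (1 + 2 * b + 2 * c) * τ - c * K⁻¹ / 4 + 20 * W * s * τ * L
          + 20 * s * L) * Z
        + τ ^ 2 * (s * (s * L * (1 + 2 * b + 2 * c)) + 20 * W * s ^ 2 * L - 1 / 2) * E
        + s * τ * (2 * L * κ ^ 2 + (4 * b + 8 * c) * K * L * κ ^ 2 + 10 * κ ^ 2 * s) * V := by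
    have t1 := mul_le_mul_of_nonneg_left dY' hb0.le
    have t2 := mul_le_mul_of_nonneg_left dZ' hc0.le
    refine (add_le_add (add_le_add (add_le_add dM' t1) t2) dE').trans (le_of_eq ?_)
    ring
  have total2 := mul_le_mul_of_nonneg_left total hκ0.le
  have nV := mul_nonpos_of_nonneg_of_nonpos
    (show 0 ≤ κ * s * τ * V by positivity) cV
  have nY := mul_nonpos_of_nonneg_of_nonpos
    (show 0 ≤ κ * (s * τ * Y) by positivity) cY
  have nZ := mul_nonpos_of_nonneg_of_nonpos
    (show 0 ≤ κ * (s * τ * Z) by positivity) cZ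
  have nE := mul_nonpos_of_nonneg_of_nonpos
    (show 0 ≤ κ * (τ ^ 2 * E) by positivity) cE
  have nM : 0 ≤ κ * s * τ * M := by positivity
  linarith

namespace FiniteSumBilevel

/-- The Lyapunov function of MA-SABA. -/
def lyapunov (B : FiniteSumBilevel dx dy n m) (θ : Params) (κ b c W : ℝ) (S : State dx dy n m) :
    ℝ :=
  B.H S.u.x + κ * (B.dirErr θ S + b * B.yErr S.u + c * B.zErr S.u + W * S.w.err S.u)

variable {B : FiniteSumBilevel dx dy n m}
namespace Regular

variable {K : ℝ} (hB : B.Regular K)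
include hB

/-- Expected decrease of the Lyapunov function in one iteration; `τ` is `(n + m)^(-2/3)`. -/
lemma mean_lyapunov_step_le {κ s b c τ : ℝ} (h : LyapunovConstants K (lipConst K) κ s b c)
    (hτ : 0 < τ) (hτ1 : τ ≤ 1) (hN : (n + m : ℝ) ^ 2 * τ ^ 3 = 1) {θ : Params}
    (hα : θ.α = κ * s * τ) (hβ : θ.β = s * τ) (hγ : θ.γ = s * τ) (hρ : θ.ρ = s * τ)
    (S : State dx dy n m) :
    mean (fun t => B.lyapunov θ κ b c ((n + m) * τ ^ 2) (B.step θ S t))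
      ≤ B.lyapunov θ κ b c ((n + m) * τ ^ 2) S
        - κ * s * τ / 2 * ‖B.hyperGrad S.u.x‖ ^ 2 := by
  have := hB.neZero_n
  have := hB.neZero_m
  have h' := h
  obtain ⟨hκ0, hs0, hb0, hc0, hκ, hκ1, hs1, hsL, hsLK, hsbc, hb, hc⟩ := h
  have hK := hB.pos
  have hL := hB.one_le_lipConst
  set L := lipConst K
  have hL0 : 0 < L := by linarith
  have hn : (1 : ℝ) ≤ n := by exact_mod_cast hB.n_pos
  have hm : (1 : ℝ) ≤ m := by exact_mod_cast hB.m_pos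
  set N : ℝ := n + m with hNdef
  have hN0 : 0 < N := by linarith
  have hst : s * τ ≤ s := mul_le_of_le_one_right hs0.le hτ1
  have hst0 : 0 < s * τ := by positivity
  have hstL : s * τ * (2 * L * K) ≤ 1 :=
    (mul_le_mul_of_nonneg_right hst (by positivity)).trans (by linarith)
  have stepL : 2 * (s * τ) * L ≤ K⁻¹ := by
    rw [← one_div, le_div_iff₀ hK]; linarith
  have dM := hB.mean_dirErr_step_le θ S (by rw [hρ]; exact hst0) (by rw [hρ]; linarith)
  have dY := hB.mean_yErr_step_le θ S (by rw [hβ]; exact hst0) (by rw [hβ]; linarith)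
    (by rw [hβ]; refine le_trans ?_ stepL; nlinarith)
  have dZ := hB.mean_zErr_step_le θ S (by rw [hγ]; exact hst0) (by rw [hγ]; linarith)
    (by rw [hγ]; exact stepL)
  have dE := hB.mean_memErr_step_le θ S
  have dH : mean (fun t => B.H (B.step θ S t).u.x) ≤ _ :=
    (mean_mono (fun t => hB.H_step_le θ S t)).trans (le_of_eq (mean_const _))
  have e : mean (fun t => B.lyapunov θ κ b c (N * τ ^ 2) (B.step θ S t))
      = mean (fun t => B.H (B.step θ S t).u.x) + κ * (mean (fun t => B.dirErr θ (B.step θ S t))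
        + b * mean (fun t => B.yErr (B.step θ S t).u) + c * mean (fun t => B.zErr (B.step θ S t).u)
        + N * τ ^ 2 * mean (fun t => (B.step θ S t).w.err (B.step θ S t).u)) := by
    unfold lyapunov
    simp_rw [mean_add, mean_mul, mean_add, mean_mul]
  rw [e, lyapunov]
  rw [hα] at dH
  rw [hα, hρ] at dM
  rw [hα, hβ] at dY
  rw [hα, hγ] at dZ
  rw [hα, hβ, hγ] at dE
  exact lyapunov_combination h' hK hL hτ hτ1 hN0 hN (sq_nonneg _) (B.dirErr_nonneg θ S)
    (B.yErr_nonneg S.u) (B.zErr_nonneg S.u) (S.w.err_nonneg S.u) dH dM dY dZ dE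

end Regular
end FiniteSumBilevel

/-! ### The initial Lyapunov gap -/

lemma Triple.Within.sqDist_le {u w : Triple dx dy} {R : ℝ} (h : w.Within u R) :
    u.sqDist w ≤ 3 * R ^ 2 := by
  obtain ⟨h1, h2, h3⟩ := h
  rw [norm_sub_rev] at h1 h2 h3
  have := pow_le_pow_left₀ (norm_nonneg _) h1 2
  have := pow_le_pow_left₀ (norm_nonneg _) h2 2
  have := pow_le_pow_left₀ (norm_nonneg _) h3 2
  rw [Triple.sqDist]
  linarith

lemma tableErr_le {ι : Type*} [Fintype ι] [Nonempty ι] {u : Triple dx dy} {w : ι → Triple dx dy}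
    {c : ℝ} (h : ∀ i, u.sqDist (w i) ≤ c) : tableErr u w ≤ c :=
  (mean_mono h).trans (le_of_eq (mean_const c))

/-- The deviation of a SAGA estimate formed near `u` from the full average at `u`. -/
lemma saga_sub_mean_sq_le {N : ℕ} [NeZero N] {E : Type*} [NormedAddCommGroup E]
    [InnerProductSpace ℝ E] (φ : Fin N → Triple dx dy → E) (w : Fin N → Triple dx dy)
    (u u' : Triple dx dy) (i : Fin N) {q : ℝ} (hw : ∀ i, ‖φ i u - φ i (w i)‖ ^ 2 ≤ q)
    (hu : ‖φ i u - φ i u'‖ ^ 2 ≤ q) :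
    ‖saga φ w u' i - mean fun i => φ i u‖ ^ 2 ≤ 10 * q := by
  have e : saga φ w u' i - (mean fun i => φ i u)
      = ((φ i u - φ i (w i)) - (φ i u - φ i u')) - mean fun i => (φ i u - φ i (w i)) := by
    rw [saga_eq, mean_sub]; abel
  have h1 := norm_sub_sq_le_two (φ i u - φ i (w i)) (φ i u - φ i u')
  have h2 := norm_sub_sq_le_two ((φ i u - φ i (w i)) - (φ i u - φ i u'))
    (mean fun i => (φ i u - φ i (w i)))
  have h3 : ‖mean fun i => (φ i u - φ i (w i))‖ ^ 2 ≤ q :=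
    (norm_mean_sq_le _).trans ((mean_mono hw).trans (le_of_eq (mean_const q)))
  rw [e]
  linarith [hw i]

namespace FiniteSumBilevel

/-- A bound on the initial Lyapunov gap. -/
def initialBound (K b c R : ℝ) : ℝ :=
  R + (2 * R ^ 2 + 8 * lipConst K * R
    + (20 * lipConst K * (3 * R ^ 2 + (R + K ^ 2) ^ 2)
      + 2 * lipConst K * (R ^ 2 + (R + K ^ 2) ^ 2)))
    + b * R ^ 2 + c * (R + K ^ 2) ^ 2 + 6 * R ^ 2

variable {B : FiniteSumBilevel dx dy n m}
namespace Regular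

variable {K : ℝ} (hB : B.Regular K)
include hB

/-- A gradient step of length 1/(2L) lowers H by at least ‖∇H‖²/(4L), and this decrease cannot
exceed the gap. It bounds ∇H(x₀) without assuming such a bound on the input. -/
lemma hyperGrad_sq_le_of_gap {x : Vec dx} {R : ℝ} (h : ∀ x', B.H x - B.H x' ≤ R) :
    ‖B.hyperGrad x‖ ^ 2 ≤ 4 * lipConst K * R := by
  have hL : 0 < lipConst K := by linarith [hB.one_le_lipConst]
  have h1 := hB.H_le x (x - (2 * lipConst K)⁻¹ • B.hyperGrad x)
  have h2 := h (x - (2 * lipConst K)⁻¹ • B.hyperGrad x)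
  rw [sub_sub_cancel_left, inner_neg_right, inner_smul_right, real_inner_self_eq_norm_sq, norm_neg,
    norm_smul, mul_pow, Real.norm_eq_abs, sq_abs] at h1
  have e : (2 * lipConst K)⁻¹ * ‖B.hyperGrad x‖ ^ 2
      - lipConst K * ((2 * lipConst K)⁻¹ ^ 2 * ‖B.hyperGrad x‖ ^ 2)
      = (4 * lipConst K)⁻¹ * ‖B.hyperGrad x‖ ^ 2 := by
    field_simp; ring
  have h3 : (4 * lipConst K)⁻¹ * ‖B.hyperGrad x‖ ^ 2 ≤ R := by linarith
  rwa [inv_mul_le_iff₀ (by positivity)] at h3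

/-- The bound holds for every initial draw, not only on average. The first estimate is formed at u₋₁
and is compared with the full direction at u₀, to which u₋₁ and all memory entries are close. -/
lemma lyapunov_start_le {I : Init dx dy n m} {R : ℝ} (hI : I.BoundedBy B R) {θ : Params}
    {κ b c W : ℝ} (hρ : 0 ≤ θ.ρ) (hρ1 : θ.ρ ≤ 1) (hκ1 : κ ≤ 1) (hb : 0 ≤ b)
    (hc : 0 ≤ c) (hW : 0 ≤ W) (hW1 : W ≤ 1) (s : Fin n × Fin m) (x : Vec dx) :
    B.lyapunov θ κ b c W (B.start I s) - B.H x ≤ initialBound K b c R := by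
  have := hB.neZero_n
  have := hB.neZero_m
  have hR : 0 ≤ R := (norm_nonneg _).trans hI.z0
  have hL := hB.one_le_lipConst
  have hY : B.yErr I.u0 ≤ R ^ 2 := pow_le_pow_left₀ (norm_nonneg _) hI.lower 2
  have hZ : B.zErr I.u0 ≤ (R + K ^ 2) ^ 2 :=
    pow_le_pow_left₀ (norm_nonneg _) ((norm_sub_le _ _).trans
      (add_le_add hI.z0 (hB.norm_zStar_le _))) 2
  have hY0 := B.yErr_nonneg I.u0
  have hZ0 := B.zErr_nonneg I.u0
  have hE0 := (I.w.update s I.uPrev).err_nonneg I.u0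
  have hE : (I.w.update s I.uPrev).err I.u0 ≤ 6 * R ^ 2 := by
    have h1 : tableErr I.u0 (Function.update I.w.f s.1 I.uPrev) ≤ 3 * R ^ 2 := by
      refine tableErr_le fun i => ?_
      rw [Function.update_apply]
      split_ifs
      exacts [hI.uPrev.sqDist_le, (hI.memf i).sqDist_le]
    have h2 : tableErr I.u0 (Function.update I.w.g s.2 I.uPrev) ≤ 3 * R ^ 2 := by
      refine tableErr_le fun i => ?_
      rw [Function.update_apply]
      split_ifs
      exacts [hI.uPrev.sqDist_le, (hI.memg i).sqDist_le]
    exact (add_le_add h1 h2).trans (by linarith)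
  set Zb := (R + K ^ 2) ^ 2 with hZb
  have comp : ∀ {w : Triple dx dy} {a : ℝ}, w.Within I.u0 R →
      a ≤ lipConst K / 4 * (I.u0.sqDist w + B.zErr I.u0) →
      a ≤ lipConst K / 4 * (3 * R ^ 2 + Zb) := by
    intro w a hw ha
    refine ha.trans ?_
    gcongr
    exact hw.sqDist_le
  have hD : ‖B.estX I.w I.uPrev s - B.dirX I.u0‖ ^ 2 ≤ 10 * lipConst K * (3 * R ^ 2 + Zb) := by
    have h1 := saga_sub_mean_sq_le (fun i u => grad1 (B.F i) (joint u.x u.y)) I.w.f I.u0 I.uPrev s.1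
      (fun i => comp (hI.memf i) (hB.grad1_F_sub_sq_le i I.u0 (I.w.f i)))
      (comp hI.uPrev (hB.grad1_F_sub_sq_le s.1 I.u0 I.uPrev))
    have h2 := saga_sub_mean_sq_le (fun j u => hess12 (B.G j) (joint u.x u.y) u.z) I.w.g I.u0
      I.uPrev s.2 (fun j => comp (hI.memg j) (hB.hess12_G_sub_sq_le j I.u0 (I.w.g j)))
      (comp hI.uPrev (hB.hess12_G_sub_sq_le s.2 I.u0 I.uPrev))
    rw [hB.mean_grad1_F] at h1
    rw [hB.mean_hess12_G] at h2
    rw [estX, dirX, sub_sub_sub_comm]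
    refine (norm_sub_sq_le_two _ _).trans ?_
    linarith
  have hM : B.dirErr θ (B.start I s) ≤ 2 * R ^ 2 + 8 * lipConst K * R
      + (20 * lipConst K * (3 * R ^ 2 + Zb) + 2 * lipConst K * (R ^ 2 + Zb)) := by
    set g := B.hyperGrad I.u0.x
    have e : B.dirErr θ (B.start I s)
        = ‖(1 - θ.ρ) • (I.vPrev - g) + θ.ρ • (B.estX I.w I.uPrev s - g)‖ ^ 2 := by
      have : (1 - θ.ρ) • I.vPrev + θ.ρ • B.estX I.w I.uPrev s - g
          = (1 - θ.ρ) • (I.vPrev - g) + θ.ρ • (B.estX I.w I.uPrev s - g) := by module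
      rw [← this]; rfl
    have h1 := norm_convex_comb_sq_le θ.ρ hρ hρ1 (I.vPrev - g) (B.estX I.w I.uPrev s - g)
    have h2 := norm_sub_sq_le_two I.vPrev g
    have h3 := hB.hyperGrad_sq_le_of_gap hI.gap
    have h4 := pow_le_pow_left₀ (norm_nonneg _) hI.vPrev 2
    have h5 := norm_add_sq_le_two (B.estX I.w I.uPrev s - B.dirX I.u0) (B.dirX I.u0 - g)
    rw [sub_add_sub_cancel] at h5
    have h6 := hB.dirX_sub_sq_le I.u0
    have h7 : lipConst K * (B.yErr I.u0 + B.zErr I.u0) ≤ lipConst K * (R ^ 2 + Zb) := by gcongr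
    have h8 : (1 - θ.ρ) * ‖I.vPrev - g‖ ^ 2 ≤ ‖I.vPrev - g‖ ^ 2 :=
      mul_le_of_le_one_left (sq_nonneg _) (by linarith)
    have h9 : θ.ρ * ‖B.estX I.w I.uPrev s - g‖ ^ 2 ≤ ‖B.estX I.w I.uPrev s - g‖ ^ 2 :=
      mul_le_of_le_one_left (sq_nonneg _) hρ1
    rw [e]
    linarith
  have hM0 := B.dirErr_nonneg θ (B.start I s)
  have hgap := hI.gap x
  have h1 : b * B.yErr I.u0 ≤ b * R ^ 2 := by gcongr
  have h2 : c * B.zErr I.u0 ≤ c * Zb := by gcongr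
  have h3 : W * (I.w.update s I.uPrev).err I.u0 ≤ 6 * R ^ 2 :=
    (mul_le_of_le_one_left hE0 hW1).trans hE
  have h4 : κ * (B.dirErr θ (B.start I s) + b * B.yErr I.u0 + c * B.zErr I.u0
      + W * (I.w.update s I.uPrev).err I.u0) ≤ B.dirErr θ (B.start I s) + b * B.yErr I.u0
      + c * B.zErr I.u0 + W * (I.w.update s I.uPrev).err I.u0 :=
    mul_le_of_le_one_left (by positivity) hκ1
  change B.H I.u0.x + κ * (B.dirErr θ (B.start I s) + b * B.yErr I.u0 + c * B.zErr I.u0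
      + W * (I.w.update s I.uPrev).err I.u0) - B.H x ≤ _
  rw [initialBound]
  linarith

omit hB in
lemma le_lyapunov {θ : Params} {κ b c W : ℝ} (hκ : 0 ≤ κ) (hb : 0 ≤ b) (hc : 0 ≤ c) (hW : 0 ≤ W)
    (S : State dx dy n m) : B.H S.u.x ≤ B.lyapunov θ κ b c W S := by
  have := B.dirErr_nonneg θ S
  have := B.yErr_nonneg S.u
  have := B.zErr_nonneg S.u
  have := S.w.err_nonneg S.u
  rw [lyapunov]
  exact le_add_of_nonneg_right (by positivity)

end Regular

lemma run_congr (θ : Params) (I : Init dx dy n m) {s s' : ℕ → Fin n × Fin m} {k : ℕ}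
    (h : ∀ t ≤ k, s t = s' t) : B.run θ I s k = B.run θ I s' k := by
  induction k with
  | zero => simp only [run, h 0 le_rfl]
  | succ k ih =>
    simp only [run]
    rw [ih fun t ht => h t (by omega), h (k + 1) le_rfl]

lemma run_calls (θ : Params) (I : Init dx dy n m) (s : ℕ → Fin n × Fin m) (k : ℕ) :
    (B.run θ I s k).calls = 2 * n + 3 * m + 5 * (k + 1) := by
  induction k with
  | zero => simp [run, start]
  | succ k ih =>
    simp only [run, step, ih]
    omega

end FiniteSumBilevel

/-! ### Expectations over the drawn indices -/

section Probability

variable {Ω : Type*} [MeasurableSpace Ω] {P : Measure Ω} [IsProbabilityMeasure P]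

/-- Up to any fixed time only finitely many index sequences occur, so expectations along the run
exist without any measurability argument for the maps of the method. -/
lemma integrable_comp_finite {α : Type*} [Finite α] [MeasurableSpace α] [MeasurableSingletonClass α]
    {X : Ω → α} (hX : Measurable X) (ψ : α → ℝ) : Integrable (fun ω => ψ (X ω)) P := by
  have : IsProbabilityMeasure (P.map X) := Measure.isProbabilityMeasure_map hX.aemeasurable
  exact (Integrable.of_finite (μ := P.map X) (f := ψ)).comp_measurable hX

/-- Integrating out an independent uniform variable with finitely many values. -/
lemma integral_indep_uniform {α A : Type*} [Finite α] [MeasurableSpace α]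
    [MeasurableSingletonClass α] [Fintype A] [MeasurableSpace A] [MeasurableSingletonClass A]
    {X : Ω → α} {Y : Ω → A} (hX : Measurable X) (hY : Measurable Y) (h : IndepFun X Y P)
    (hu : ∀ a, P (Y ⁻¹' {a}) = (Fintype.card A : ℝ≥0∞)⁻¹) (ψ : α → A → ℝ) :
    ∫ ω, ψ (X ω) (Y ω) ∂P = ∫ ω, mean (ψ (X ω)) ∂P := by
  classical
  -- Splitting by the value of `Y` turns the integrand into a finite sum of products of independent
  -- factors.
  have e1 : ∀ ω, ψ (X ω) (Y ω) = ∑ a, ψ (X ω) a * (if Y ω = a then 1 else 0) := by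
    intro ω; simp
  have e2 : ∀ a, ∫ ω, ψ (X ω) a * (if Y ω = a then 1 else 0) ∂P
      = (∫ ω, ψ (X ω) a ∂P) * (1 / (Fintype.card A : ℝ)) := by
    intro a
    have hi : IndepFun (fun ω => ψ (X ω) a) (fun ω => if Y ω = a then (1 : ℝ) else 0) P :=
      h.comp (φ := fun x => ψ x a) (ψ := fun y => if y = a then (1 : ℝ) else 0)
        (Measurable.of_discrete) (Measurable.of_discrete)
    rw [hi.integral_fun_mul_eq_mul_integral
      (integrable_comp_finite hX fun x => ψ x a).aestronglyMeasurable
      (integrable_comp_finite hY fun y => if y = a then (1 : ℝ) else 0).aestronglyMeasurable]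
    congr 1
    have : (fun ω => if Y ω = a then (1 : ℝ) else 0) = (Y ⁻¹' {a}).indicator 1 := by
      funext ω; simp [Set.indicator_apply]
    rw [this, integral_indicator_one (hY (measurableSet_singleton a)), Measure.real, hu]
    simp
  simp_rw [e1, mean, smul_eq_mul]
  rw [integral_finsetSum _ fun a _ => ?_, integral_const_mul, integral_finsetSum _ fun a _ =>
    integrable_comp_finite hX fun x => ψ x a]
  · simp_rw [e2]
    rw [← Finset.sum_mul, mul_comm]
  · exact integrable_comp_finite (hX.prodMk hY) fun p => ψ p.1 a * if p.2 = a then 1 else 0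

end Probability

namespace FiniteSumBilevel

/-- The state after `k` iterations is a function of the finitely many indices drawn so far. -/
lemma exists_run_eq (B : FiniteSumBilevel dx dy n m) (θ : Params) (I : Init dx dy n m)
    {Ω : Type*} (s : ℕ → Ω → Fin n × Fin m) (k : ℕ) :
    ∃ r : (Finset.range (k + 1) → Fin n × Fin m) → State dx dy n m,
      ∀ ω, B.run θ I (fun t => s t ω) k = r fun t => s t ω := by
  -- The state after k iterations uses the k + 1 draws with indices 0 to k, index 0 being time -1.
  -- The value chosen outside this range is never read.
  refine ⟨fun τ => B.run θ I (fun t => if h : t ∈ Finset.range (k + 1) then τ ⟨t, h⟩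
    else τ ⟨0, by simp⟩) k, fun ω => run_congr θ I fun t ht => ?_⟩
  have : t ∈ Finset.range (k + 1) := by simp; omega
  simp only [this, dite_true]

section Run

variable {B : FiniteSumBilevel dx dy n m}
  {Ω : Type*} [MeasurableSpace Ω] {P : Measure Ω} [IsProbabilityMeasure P]
  {s : ℕ → Ω → Fin n × Fin m}

lemma integrable_run (hs : UniformSampling P s) (θ : Params) (I : Init dx dy n m) (k : ℕ)
    (ψ : State dx dy n m → ℝ) : Integrable (fun ω => ψ (B.run θ I (fun t => s t ω) k)) P := by
  obtain ⟨r, hr⟩ := exists_run_eq B θ I s k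
  simp_rw [hr]
  exact integrable_comp_finite (X := fun ω (t : Finset.range (k + 1)) => s t ω)
    (measurable_pi_lambda _ fun t => hs.measurable t) fun τ => ψ (r τ)

/-- Plays the role of conditioning on the past: the state after k iterations depends on the draws 0
to k, which are independent of draw k + 1. -/
lemma integral_run_succ (hs : UniformSampling P s) (θ : Params) (I : Init dx dy n m) (k : ℕ)
    (ψ : State dx dy n m → ℝ) :
    ∫ ω, ψ (B.run θ I (fun t => s t ω) (k + 1)) ∂P
      = ∫ ω, mean (fun a => ψ (B.step θ (B.run θ I (fun t => s t ω) k) a)) ∂P := by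
  obtain ⟨r, hr⟩ := exists_run_eq B θ I s k
  simp only [run]
  simp_rw [hr]
  have hind : IndepFun (fun ω (t : Finset.range (k + 1)) => s t ω) (s (k + 1)) P := by
    have h := hs.indep.indepFun_finset (Finset.range (k + 1)) {k + 1} (by simp) hs.measurable
    exact h.comp (φ := id) (ψ := fun τ : (({k + 1} : Finset ℕ) → Fin n × Fin m) =>
      τ ⟨k + 1, by simp⟩) measurable_id (measurable_pi_apply _)
  refine integral_indep_uniform (X := fun ω (t : Finset.range (k + 1)) => s t ω)
    (measurable_pi_lambda _ fun t => hs.measurable t)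
    (hs.measurable (k + 1)) hind (fun a => ?_) fun τ a => ψ (B.step θ (r τ) a)
  rw [hs.uniform]
  simp

lemma sum_integral_hyperGrad_le {K : ℝ} (hB : B.Regular K) {κ c₀ b c τ : ℝ}
    (h : LyapunovConstants K (lipConst K) κ c₀ b c)
    (hτ : 0 < τ) (hτ1 : τ ≤ 1) (hN : (n + m : ℝ) ^ 2 * τ ^ 3 = 1) {θ : Params}
    (hα : θ.α = κ * c₀ * τ) (hβ : θ.β = c₀ * τ) (hγ : θ.γ = c₀ * τ) (hρ : θ.ρ = c₀ * τ)
    {I : Init dx dy n m} {R : ℝ} (hI : I.BoundedBy B R) (hs : UniformSampling P s) (T : ℕ) :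
    κ * c₀ * τ / 2 * ∑ k ∈ Finset.range T,
      ∫ ω, ‖gradient B.H (B.run θ I (fun t => s t ω) k).u.x‖ ^ 2 ∂P
      ≤ initialBound K b c R := by
  set W : ℝ := (n + m) * τ ^ 2 with hW
  have hW0 : 0 ≤ W := by positivity
  have hW1 : W ≤ 1 := by
    have : W ^ 2 ≤ 1 := by
      calc W ^ 2 = ((n + m : ℝ) ^ 2 * τ ^ 3) * τ := by rw [hW]; ring
        _ ≤ 1 := by rw [hN, one_mul]; exact hτ1
    nlinarith
  set Φ := B.lyapunov θ κ b c W with hΦ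
  set X : ℕ → Ω → State dx dy n m := fun k ω => B.run θ I (fun t => s t ω) k with hX
  have hint : ∀ k (ψ : State dx dy n m → ℝ), Integrable (fun ω => ψ (X k ω)) P :=
    fun k ψ => integrable_run hs θ I k ψ
  have hstep : ∀ k, ∫ ω, Φ (X (k + 1) ω) ∂P ≤ ∫ ω, Φ (X k ω) ∂P
      - κ * c₀ * τ / 2 * ∫ ω, ‖gradient B.H (X k ω).u.x‖ ^ 2 ∂P := by
    intro k
    rw [integral_run_succ hs θ I k Φ, ← integral_const_mul,
      ← integral_sub (hint k Φ) ((hint k fun S => ‖gradient B.H S.u.x‖ ^ 2).const_mul _)]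
    refine integral_mono (hint k fun S => mean fun a => Φ (B.step θ S a))
      ((hint k Φ).sub ((hint k fun S => ‖gradient B.H S.u.x‖ ^ 2).const_mul _)) fun ω => ?_
    simp only [hB.gradient_H]
    exact hB.mean_lyapunov_step_le h hτ hτ1 hN hα hβ hγ hρ (X k ω)
  have hsum : ∀ T : ℕ, κ * c₀ * τ / 2 * ∑ k ∈ Finset.range T,
      ∫ ω, ‖gradient B.H (X k ω).u.x‖ ^ 2 ∂P ≤ ∫ ω, Φ (X 0 ω) ∂P - ∫ ω, Φ (X T ω) ∂P := by
    intro T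
    induction T with
    | zero => simp
    | succ T ih =>
      rw [Finset.sum_range_succ, mul_add]
      linarith [hstep T]
  refine (hsum T).trans ?_
  rw [← integral_sub (hint 0 Φ) (hint T Φ)]
  -- The potential dominates H, so the gap hypothesis at the random point x_T bounds the telescoped
  -- difference pathwise.
  have hle : ∀ ω, Φ (X 0 ω) - Φ (X T ω) ≤ initialBound K b c R := by
    intro ω
    have hst : c₀ * τ ≤ 1 := mul_le_one₀ h.s_le_one hτ.le hτ1
    have h1 := hB.lyapunov_start_le hI (θ := θ) (κ := κ) (b := b) (c := c) (W := W)
      (by rw [hρ]; exact (mul_pos h.s_pos hτ).le) (by rw [hρ]; exact hst) h.κ_le_one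
      h.b_pos.le h.c_pos.le hW0 hW1 (s 0 ω) (X T ω).u.x
    have h2 := Regular.le_lyapunov (B := B) (θ := θ) h.κ_pos.le h.b_pos.le h.c_pos.le hW0 (X T ω)
    change B.lyapunov θ κ b c W (B.start I (s 0 ω)) - _ ≤ _
    linarith
  calc _ ≤ ∫ _, initialBound K b c R ∂P := integral_mono ((hint 0 Φ).sub (hint T Φ))
        (integrable_const _) hle
    _ = _ := by simp

end Run
end FiniteSumBilevel

/-! ### The rate and the number of calls -/

/-- The scale `τ = (n + m)^(-2/3)`. -/
lemma rpow_scale_facts {N : ℝ} (hN : 1 ≤ N) :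
    0 < N ^ (-(2 / 3) : ℝ) ∧ N ^ (-(2 / 3) : ℝ) ≤ 1 ∧ N ^ 2 * (N ^ (-(2 / 3) : ℝ)) ^ 3 = 1 ∧
      (N ^ (-(2 / 3) : ℝ))⁻¹ = N ^ (2 / 3 : ℝ) := by
  have h0 : 0 < N := by linarith
  refine ⟨by positivity, Real.rpow_le_one_of_one_le_of_nonpos hN (by norm_num), ?_, ?_⟩
  · rw [← Real.rpow_natCast (N ^ (-(2 / 3) : ℝ)) 3, ← Real.rpow_mul h0.le, ← Real.rpow_natCast N 2,
      ← Real.rpow_add h0]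
    norm_num
  · rw [Real.rpow_neg h0.le, inv_inv]

end

theorem mainTheorem3 (Lf Lg1 Lg2 : ℝ≥0) (Cf μ : ℝ) (hCf : 0 < Cf) (hμ : 0 < μ) :
    ∃ c₁ c₂ c₃ c₄ : ℝ, 0 < c₁ ∧ 0 < c₂ ∧ 0 < c₃ ∧ 0 < c₄ ∧
      ∀ R : ℝ, ∃ C : ℝ, 0 < C ∧
        ∀ (dx dy n m : ℕ), 0 < n → 0 < m →
        ∀ B : FiniteSumBilevel dx dy n m, B.Assumptions Lf Lg1 Lg2 Cf μ →
          Differentiable ℝ B.H ∧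
          ∀ I : Init dx dy n m, I.BoundedBy B R →
          ∀ (Ω : Type*) [MeasurableSpace Ω] (P : Measure Ω) [IsProbabilityMeasure P]
            (s : ℕ → Ω → Fin n × Fin m), UniformSampling P s →
            (∀ K : ℕ, 1 < K →
              B.avgSqGrad P (scaledParams c₁ c₂ c₃ c₄ n m) I s K
                ≤ C * (((n : ℝ) + m) ^ (2 / 3 : ℝ) / K)) ∧
            (∀ ε : ℝ, 0 < ε → ε ≤ ((n : ℝ) + m) ^ (2 / 3 : ℝ) →
              ∃ K : ℕ, 1 < K ∧
                B.avgSqGrad P (scaledParams c₁ c₂ c₃ c₄ n m) I s K ≤ ε ∧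
                ∀ ω, ((B.run (scaledParams c₁ c₂ c₃ c₄ n m) I (fun t => s t ω) K).calls : ℝ)
                  ≤ (2 * n + 3 * m) + C * (((n : ℝ) + m) ^ (2 / 3 : ℝ) / ε)) := by
  obtain ⟨K₀, hK₀⟩ : ∃ K₀ : ℝ, K₀ = 1 + Lf + Lg1 + Lg2 + Cf + μ⁻¹ := ⟨_, rfl⟩
  have hK1 : 1 ≤ K₀ := by
    have := Lf.coe_nonneg
    have := Lg1.coe_nonneg
    have := Lg2.coe_nonneg
    have := inv_pos.2 hμ
    rw [hK₀]
    linarith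
  have hL1 : 1 ≤ FiniteSumBilevel.lipConst K₀ := by
    unfold FiniteSumBilevel.lipConst
    linarith [one_le_pow₀ (n := 14) hK1]
  obtain ⟨κ, c₀, b, c, h⟩ := exists_lyapunovConstants hK1 hL1
  have hκ := h.κ_pos
  have hc₀ := h.s_pos
  refine ⟨κ * c₀, c₀, c₀, c₀, mul_pos hκ hc₀, hc₀, hc₀, hc₀, fun R => ?_⟩
  -- The telescoped sum is divided by κ c₀ τ / 2. The absolute value keeps the constant nonnegative
  -- for every real R, including negative ones.
  set C₁ : ℝ := 2 / (κ * c₀) * |FiniteSumBilevel.initialBound K₀ b c R| with hC₁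
  have hC₁0 : 0 ≤ C₁ := by positivity
  -- With q = T/ε ≥ 1 and K < C₁ q + 3, the 5 (K + 1) calls number at most 5 C₁ q + 20 ≤ (5 C₁ + 20)
  -- q.
  refine ⟨5 * C₁ + 20, by positivity, fun dx dy n m hn hm B hBA => ?_⟩
  have hB : B.Regular K₀ := by
    rw [hK₀]
    exact hBA.regular hn hm hCf hμ
  refine ⟨hB.differentiable_H, fun I hI Ω _ P _ s hs => ?_⟩
  have hN : (1 : ℝ) ≤ (n : ℝ) + m := by
    have : (1 : ℝ) ≤ n := by exact_mod_cast hn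
    have : (0 : ℝ) ≤ m := Nat.cast_nonneg m
    linarith
  obtain ⟨hτ, hτ1, hNτ, hτinv⟩ := rpow_scale_facts hN
  set θ := scaledParams (κ * c₀) c₀ c₀ c₀ n m with hθ
  set T : ℝ := ((n : ℝ) + m) ^ (2 / 3 : ℝ) with hT
  have hT0 : 0 < T := by positivity
  have rate : ∀ K : ℕ, 1 < K → B.avgSqGrad P θ I s K ≤ C₁ * (T / K) := by
    intro K hK
    have hKpos : (0 : ℝ) < K := by exact_mod_cast (by omega : 0 < K)
    have hsum := (FiniteSumBilevel.sum_integral_hyperGrad_le hB h hτ hτ1 hNτ (θ := θ) rfl rfl rfl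
      rfl hI hs K).trans (le_abs_self _)
    rw [FiniteSumBilevel.avgSqGrad, one_div, inv_mul_le_iff₀ hKpos]
    set τ := ((n : ℝ) + m) ^ (-(2 / 3) : ℝ)
    rw [mul_comm, ← le_div_iff₀ (by positivity)] at hsum
    refine hsum.trans (le_of_eq ?_)
    rw [hC₁, ← hτinv]
    field_simp
  refine ⟨fun K hK => (rate K hK).trans ?_, fun ε hε hεT => ?_⟩
  · gcongr
    linarith
  · have hq : 1 ≤ T / ε := (one_le_div hε).2 hεT
    have hK := Nat.le_ceil (C₁ * (T / ε))
    have hK' := Nat.ceil_lt_add_one (show 0 ≤ C₁ * (T / ε) by positivity)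
    -- The summand 2 ensures K > 1 even when the ceiling is 0.
    refine ⟨⌈C₁ * (T / ε)⌉₊ + 2, by omega, (rate _ (by omega)).trans ?_, fun ω => ?_⟩
    · have hpos : (0 : ℝ) < ((⌈C₁ * (T / ε)⌉₊ + 2 : ℕ) : ℝ) := by positivity
      rw [← mul_div_assoc, div_le_iff₀ hpos]
      have : C₁ * (T / ε) ≤ ((⌈C₁ * (T / ε)⌉₊ + 2 : ℕ) : ℝ) := by push_cast; linarith
      calc C₁ * T = ε * (C₁ * (T / ε)) := by field_simp
        _ ≤ _ := by gcongr
    · rw [FiniteSumBilevel.run_calls]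
      push_cast
      linarith
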